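/- **Setting.** Let $(M,g)$ be a smooth $4$-dimensional Lorentzian manifold (signature $(-,+,+,+)$, Levi-Civita connection $\nabla$) with a double null coordinate system $(s,\underline s,\vartheta)$, $\vartheta=(\theta^1,\theta^2)$: that is, $g(\nabla s,\nabla s)=g(\nabla\underline s,\nabla\underline s)=0$; with $L'=2\nabla s$, $\underline L'=2\nabla\underline s$ one has $g(L',\underline L')>0$, and $\Omega>0$ is defined by $2\Omega^{-2}=g(L',\underline L')$; and, with $L=\Omega^2L'$, $\underline L=\Omega^2\underline L'$, the functions $\theta^1,\theta^2$ are constant along the integral curves of $L$, so that $L=\partial_{\underline s}$. Put $b=\underline L-\partial_s=b^i\partial_i$, where $\partial_i=\partial_{\theta^i}$; let $\Sigma_{s,\underline s}$ be the level surfaces of $(s,\underline s)$, $g\!\!\!/_{ij}=g(\partial_i,\partial_j)$ their metric, and $\nabla\!\!\!\!/$, $\Gamma\!\!\!\!/_{ij}^k$ the Levi-Civita connection and Christoffel symbols of $g\!\!\!/$. Put $$\chi_{ij}=g(\nabla_{\partial_i}L,\partial_j),\quad \underline\chi_{ij}=g(\nabla_{\partial_i}\underline L,\partial_j),\quad \eta_i=\tfrac12g(\nabla_{\partial_i}\underline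 L,L'),\quad \underline\eta_i=\tfrac12g(\nabla_{\partial_i}L,\underline L'),\quad \omega=L\log\Omega,\quad \underline\omega=\underline L\log\Omega .$$ Let $\Sigma$ be a spacelike surface (its induced metric is positive definite) parametrised by $\vartheta\mapsto(s,\underline s,\vartheta)=(f(\vartheta),\underline f(\vartheta),\vartheta)$ with $f,\underline f$ smooth on an open set of $\mathbb R^2$, with coordinate frame $\dot\partial_i=\partial_i+f_i\partial_s+\underline f_i\partial_{\underline s}$, where $f_i=\dot\partial_if$, $\underline f_i=\dot\partial_i\underline f$. All background quantities are evaluated on $\Sigma$. Let $B_i^j=\delta_i^j-f_ib^j$ and consider points of $\Sigma$ at which $B$ is invertible. Write $v\cdot w=g\!\!\!/_{ij}v^iw^j$, $|v|^2=v\cdot v$ for vectors, and put $$e^k=-2\Omega^2f_i(B^{-1})^i_j(g\!\!\!/^{-1})^{jk},\qquad \underline e^k=-2\Omega^2\underline f_i(B^{-1})^i_j(g\!\!\!/^{-1})^{jk},\qquad D=(2\Omega^2+e\cdot\underline e)+\sqrt{(2\Omega^2+e\cdot\underline e)^2-|e|^2|\underline e|^2},$$ $$\varepsilon=-\frac{|e|^2}{D},\qquad\underline\varepsilon=-\frac{|\underline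 e|^2}{D},\qquad \varepsilon^k=e^k+\varepsilon\underline e^k,\qquad \underline\varepsilon^k=\underline e^k+\underline\varepsilon e^k,$$ $$\dot L=L+\varepsilon\underline L+\varepsilon^i\partial_i,\qquad \underline{\dot L}=\underline L+\underline\varepsilon L+\underline\varepsilon^i\partial_i,\qquad \vec\varepsilon=(\varepsilon^1,\varepsilon^2),\quad \vec{\underline\varepsilon}=(\underline\varepsilon^1,\underline\varepsilon^2).$$ **Claim.** $\{\underline{\dot L},\dot L\}$ is a null normal frame of $\Sigma$: both vectors are null and orthogonal to $\dot\partial_1,\dot\partial_2$, and $$2\dot\Omega^2:=g(\underline{\dot L},\dot L)=2\Omega^2(1+\varepsilon\underline\varepsilon)+\vec\varepsilon\cdot\vec{\underline\varepsilon}>0 .$$ With $\dot L'=\dot\Omega^{-2}\dot L$, the null second fundamental forms and the torsion $$\underline{\dot\chi}_{ij}=g(\nabla_{\dot\partial_i}\underline{\dot L},\dot\partial_j),\qquad \dot\chi_{ij}=g(\nabla_{\dot\partial_i}\dot L,\dot\partial_j),\qquad \dot\eta_i=\tfrac12g(\nabla_{\dot\partial_i}\underline{\dot L},\dot L')$$ are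 given as follows. Here $T(v)_i=T_{ij}v^j$ and $T(v,w)=T_{ij}v^iw^j$ for $T=\chi,\underline\chi$; $v\cdot\xi=\xi_iv^i$ for a vector $v$ and a one-form $\xi$ ($\xi=\eta,\underline\eta$); $\mathrm{sym}(P\otimes Q)_{ij}=\frac12(P_iQ_j+P_jQ_i)$; $\mathrm df=(f_i)$, $\mathrm d\underline f=(\underline f_i)$; $\nabla\!\!\!\!/_ib^k=\partial_ib^k+\Gamma\!\!\!\!/^k_{ij}b^j$, $\nabla\!\!\!\!/_vb=v^i\nabla\!\!\!\!/_ib$, $(\nabla\!\!\!\!/\,b\cdot w)_i=(\nabla\!\!\!\!/_ib)\cdot w$, $(\partial b/\partial s)^k=\partial_sb^k$; and, for a function $h$ and a field $V^k$ on $\Sigma$, $\nabla\!\!\!\!/^2_{ij}h=\dot\partial_i\dot\partial_jh-\Gamma\!\!\!\!/^k_{ij}\dot\partial_kh$ and $\nabla\!\!\!\!/_iV^k=\dot\partial_iV^k+\Gamma\!\!\!\!/^k_{ij}V^j$. $$\begin{aligned}\underline{\dot\chi}_{ij}={}&\underline\chi_{ij}+\underline\varepsilon\chi_{ij}+(\vec{\underline\varepsilon}\cdot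 b-2\Omega^2\underline\varepsilon)\nabla\!\!\!\!/^2_{ij}f-2\Omega^2\nabla\!\!\!\!/^2_{ij}\underline f-2\,\mathrm{sym}\{[\chi(\vec{\underline\varepsilon})+2\Omega^2\underline\eta]\otimes \mathrm d\underline f\}_{ij}\\&+2\,\mathrm{sym}\{[\nabla\!\!\!\!/\,b\cdot\vec{\underline\varepsilon}-\underline\chi(\vec{\underline\varepsilon})-\underline\chi(b)-\underline\varepsilon\chi(b)-2\Omega^2\underline\varepsilon\eta]\otimes \mathrm df\}_{ij}\\&+2[2\Omega^2\eta\cdot\vec{\underline\varepsilon}+\chi(b,\vec{\underline\varepsilon})+2\Omega^2b\cdot\underline\eta]\,\mathrm{sym}(\mathrm df\otimes \mathrm d\underline f)_{ij}-4\omega\Omega^2\underline f_i\underline f_j\\&+[2\underline\chi(b,\vec{\underline\varepsilon})+\underline\chi(b,b)+\underline\varepsilon\chi(b,b)+4\Omega^2\underline\varepsilon\,b\cdot\eta-\nabla\!\!\!\!/_bb\cdot\vec{\underline\varepsilon}+\tfrac{\partial b}{\partial s}\cdot\vec{\underline\varepsilon}-4\Omega^2\underline\varepsilon\,\underline\omega]f_if_j,\end{aligned}$$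 $$\begin{aligned}\dot\chi_{ij}={}&\chi_{ij}+\varepsilon\underline\chi_{ij}+(\vec\varepsilon\cdot b-2\Omega^2)\nabla\!\!\!\!/^2_{ij}f-2\Omega^2\varepsilon\nabla\!\!\!\!/^2_{ij}\underline f-2\,\mathrm{sym}\{[\chi(\vec\varepsilon)+2\Omega^2\varepsilon\underline\eta]\otimes \mathrm d\underline f\}_{ij}\\&+2\,\mathrm{sym}\{[\nabla\!\!\!\!/\,b\cdot\vec\varepsilon-\underline\chi(\vec\varepsilon)-\varepsilon\underline\chi(b)-\chi(b)-2\Omega^2\eta]\otimes \mathrm df\}_{ij}\\&+2[2\Omega^2\eta\cdot\vec\varepsilon+\chi(b,\vec\varepsilon)+2\Omega^2\varepsilon\,b\cdot\underline\eta]\,\mathrm{sym}(\mathrm df\otimes \mathrm d\underline f)_{ij}-4\varepsilon\omega\Omega^2\underline f_i\underline f_j\\&+[2\underline\chi(b,\vec\varepsilon)+\chi(b,b)+\varepsilon\underline\chi(b,b)+4\Omega^2b\cdot\eta-\nabla\!\!\!\!/_bb\cdot\vec\varepsilon+\tfrac{\partial b}{\partial s}\cdot\vec\varepsilon-4\Omega^2\underline\omega]f_if_j,\end{aligned}$$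 $$\begin{aligned}\dot\eta_i={}&[2\Omega^2(1+\varepsilon\underline\varepsilon)+\vec\varepsilon\cdot\vec{\underline\varepsilon}]^{-1}\Big\{2\Omega^2\eta_i+2\Omega^2\varepsilon\underline\varepsilon\,\underline\eta_i-\chi(\vec{\underline\varepsilon})_i+\underline\varepsilon\chi(\vec\varepsilon)_i+\underline\chi(\vec\varepsilon)_i-\varepsilon\underline\chi(\vec{\underline\varepsilon})_i\\&+f_i\big[4\Omega^2\underline\omega-2\Omega^2b\cdot\eta-2\Omega^2\varepsilon\underline\varepsilon\,b\cdot\underline\eta+2\Omega^2\vec{\underline\varepsilon}\cdot\eta-2\Omega^2\underline\varepsilon\,\eta\cdot\vec\varepsilon+\chi(b,\vec{\underline\varepsilon})-\underline\varepsilon\chi(b,\vec\varepsilon)\\&\qquad+\underline\chi(\vec{\underline\varepsilon},\vec\varepsilon)-\underline\chi(b,\vec\varepsilon)+\varepsilon\underline\chi(b,\vec{\underline\varepsilon})-(\nabla\!\!\!\!/_{\vec{\underline\varepsilon}}b)\cdot\vec\varepsilon\big]\\&+\underline f_i\big[-2\Omega^2\underline\eta\cdot\vec\varepsilon+2\Omega^2\varepsilon\,\underline\eta\cdot\vec{\underline\varepsilon}+4\Omega^2\varepsilon\underline\varepsilon\omega+\chi(\vec\varepsilon,\vec{\underline\varepsilon})\big]+2\Omega^2\varepsilon\,\dot\partial_i\underline\varepsilon+(\nabla\!\!\!\!/_i\vec{\underline\varepsilon})\cdot\vec\varepsilon\Big\}.\end{aligned}$$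 -/

import Mathlib

open scoped Manifold ContDiff Matrix Bundle

noncomputable section

namespace DoubleNull

/-- The model space of the spacetime; a point is read as `(s, s̲, θ¹, θ²)`. -/
abbrev E4 : Type := EuclideanSpace ℝ (Fin 4)

/-- The model space of the surface; a point is read as `ϑ = (θ¹, θ²)`. -/
abbrev E2 : Type := EuclideanSpace ℝ (Fin 2)

/-- A smooth Lorentzian metric (signature `(-,+,+,+)`) on a smooth 4-manifold: a smooth field of
symmetric bilinear forms such that each of them is negative on some vector `v` and positive definite
on the orthogonal complement of `v`. -/
structure LorentzMetric (M : Type*) [TopologicalSpace M] [ChartedSpace E4 M]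
    [IsManifold (𝓡 4) ∞ M] where
  val : ∀ p : M, TangentSpace (𝓡 4) p →L[ℝ] TangentSpace (𝓡 4) p →L[ℝ] ℝ
  symm : ∀ (p : M) (v w : TangentSpace (𝓡 4) p), val p v w = val p w v
  lorentz : ∀ p : M, ∃ v : TangentSpace (𝓡 4) p, val p v v < 0 ∧
    ∀ w : TangentSpace (𝓡 4) p, val p v w = 0 → w ≠ 0 → 0 < val p w w
  smooth : ContMDiff (𝓡 4) ((𝓡 4).prod 𝓘(ℝ, E4 →L[ℝ] E4 →L[ℝ] ℝ)) ∞
    (fun p ↦ Bundle.TotalSpace.mk' (E4 →L[ℝ] E4 →L[ℝ] ℝ)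
      (E := fun p : M ↦ (TangentSpace (𝓡 4) p →L[ℝ] TangentSpace (𝓡 4) p →L[ℝ] ℝ)) p (val p))

/-! ### Calculus in a coordinate chart -/

/-- The partial derivative `∂ᵢ h` at `x`. -/
def pd {n : ℕ} (i : Fin n) (h : EuclideanSpace ℝ (Fin n) → ℝ) (x : EuclideanSpace ℝ (Fin n)) : ℝ :=
  fderiv ℝ h x (EuclideanSpace.single i 1)

/-- The components `g(∂_μ, ∂_ν)` of the metric in the chart `φ`, as functions of the coordinates. -/
def LorentzMetric.comp {M : Type*} [TopologicalSpace M] [ChartedSpace E4 M]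
    [IsManifold (𝓡 4) ∞ M] (g : LorentzMetric M) (φ : OpenPartialHomeomorph M E4) (x : E4) :
    Matrix (Fin 4) (Fin 4) ℝ :=
  Matrix.of fun μ ν ↦ g.val (φ.symm x)
    (mfderiv 𝓘(ℝ, E4) (𝓡 4) φ.symm x (EuclideanSpace.single μ (1 : ℝ) : E4))
    (mfderiv 𝓘(ℝ, E4) (𝓡 4) φ.symm x (EuclideanSpace.single ν (1 : ℝ) : E4))

/-- The Christoffel symbol `Γᵏᵢⱼ` of a metric, computed from its value `g` at a point and its first
derivatives `dg i a b = ∂ᵢ g_ab` at that point. -/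
def christoffel {n : ℕ} (g : Matrix (Fin n) (Fin n) ℝ) (dg : Fin n → Fin n → Fin n → ℝ)
    (k i j : Fin n) : ℝ :=
  1 / 2 * ∑ l, g⁻¹ k l * (dg i l j + dg j l i - dg l i j)

/-! In this part `G` stands for the component matrix of a Lorentzian metric in a chart with
coordinates `(s, s̲, θ¹, θ²)`, and tangent vectors are given by their components in the coordinate
frame `(∂_s, ∂_s̲, ∂₁, ∂₂)`. -/

/-- The Christoffel symbols of the Levi-Civita connection `∇` of the spacetime. -/
def Gam (G : E4 → Matrix (Fin 4) (Fin 4) ℝ) (x : E4) (μ α β : Fin 4) : ℝ :=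
  christoffel (G x) (fun i a b ↦ pd i (fun y ↦ G y a b) x) μ α β

/-- `g(v, w)` at the point `x`. -/
def ip (G : E4 → Matrix (Fin 4) (Fin 4) ℝ) (x : E4) (v w : Fin 4 → ℝ) : ℝ := v ⬝ᵥ (G x *ᵥ w)

/-- `∇_X V` at the point `x`, for a vector field `V` and a vector `X` at `x`. -/
def cov (G : E4 → Matrix (Fin 4) (Fin 4) ℝ) (X : Fin 4 → ℝ) (V : E4 → Fin 4 → ℝ) (x : E4) :
    Fin 4 → ℝ :=
  fun μ ↦ ∑ α, X α * pd α (fun y ↦ V y μ) x + ∑ α, ∑ β, Gam G x μ α β * X α * V x β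

/-- The gradient `∇h`. -/
def grad (G : E4 → Matrix (Fin 4) (Fin 4) ℝ) (h : E4 → ℝ) (x : E4) : Fin 4 → ℝ :=
  (G x)⁻¹ *ᵥ fun μ ↦ pd μ h x

/-- The coordinate vector `∂_μ`. -/
def coordVec (μ : Fin 4) : Fin 4 → ℝ := Pi.single μ 1

/-- The spacetime index of the angular coordinate `θⁱ`. -/
def ang : Fin 2 → Fin 4 := ![2, 3]

/-- `L' = 2∇s`. -/
def Lp (G : E4 → Matrix (Fin 4) (Fin 4) ℝ) (x : E4) : Fin 4 → ℝ :=
  (2 : ℝ) • grad G (fun y ↦ y 0) x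

/-- `L̲' = 2∇s̲`. -/
def Lbarp (G : E4 → Matrix (Fin 4) (Fin 4) ℝ) (x : E4) : Fin 4 → ℝ :=
  (2 : ℝ) • grad G (fun y ↦ y 1) x

/-- The positive function `Ω` with `2Ω⁻² = g(L', L̲')`. -/
def Om (G : E4 → Matrix (Fin 4) (Fin 4) ℝ) (x : E4) : ℝ :=
  Real.sqrt (2 / ip G x (Lp G x) (Lbarp G x))

/-- `L = Ω² L'`. -/
def L (G : E4 → Matrix (Fin 4) (Fin 4) ℝ) (x : E4) : Fin 4 → ℝ := (Om G x) ^ 2 • Lp G x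

/-- `L̲ = Ω² L̲'`. -/
def Lbar (G : E4 → Matrix (Fin 4) (Fin 4) ℝ) (x : E4) : Fin 4 → ℝ := (Om G x) ^ 2 • Lbarp G x

/-- The chart `φ = (s, s̲, θ¹, θ²)` is a double null coordinate system of `(M, g)`: `s` and `s̲` solve
the eikonal equation, `g(L', L̲') > 0`, and `θ¹, θ²` are constant along the integral curves of `L`
(hence `L = ∂_s̲`). That `θ¹, θ²` are also constant along `L̲` on one initial hypersurface `s̲ = 0` is
not required. -/
structure IsDoubleNull {M : Type*} [TopologicalSpace M] [ChartedSpace E4 M]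
    [IsManifold (𝓡 4) ∞ M] (g : LorentzMetric M) (φ : OpenPartialHomeomorph M E4) : Prop where
  chart : φ ∈ IsManifold.maximalAtlas (𝓡 4) ∞ M
  eikonal : ∀ x ∈ φ.target,
    ip (g.comp φ) x (grad (g.comp φ) (fun y ↦ y 0) x) (grad (g.comp φ) (fun y ↦ y 0) x) = 0
  eikonal_bar : ∀ x ∈ φ.target,
    ip (g.comp φ) x (grad (g.comp φ) (fun y ↦ y 1) x) (grad (g.comp φ) (fun y ↦ y 1) x) = 0
  pos : ∀ x ∈ φ.target, 0 < ip (g.comp φ) x (Lp (g.comp φ) x) (Lbarp (g.comp φ) x)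
  transport : ∀ x ∈ φ.target, ∀ i : Fin 2, L (g.comp φ) x (ang i) = 0

/-- The components of `b = L̲ - ∂_s`, which is tangential to `Σ_{s,s̲}`. -/
def b (G : E4 → Matrix (Fin 4) (Fin 4) ℝ) (x : E4) (k : Fin 2) : ℝ :=
  (Lbar G x - coordVec 0) (ang k)

/-- The induced metric of the surfaces `Σ_{s,s̲}`. -/
def slashg (G : E4 → Matrix (Fin 4) (Fin 4) ℝ) (x : E4) : Matrix (Fin 2) (Fin 2) ℝ :=
  Matrix.of fun i j ↦ ip G x (coordVec (ang i)) (coordVec (ang j))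

/-- The Christoffel symbols of the surfaces `Σ_{s,s̲}` in the coordinates `θ¹, θ²`. -/
def slashGam (G : E4 → Matrix (Fin 4) (Fin 4) ℝ) (x : E4) (k i j : Fin 2) : ℝ :=
  christoffel (slashg G x) (fun l a c ↦ pd (ang l) (fun y ↦ slashg G y a c) x) k i j

/-! ### Structure coefficients of the double null foliation -/

/-- `χᵢⱼ = g(∇_{∂ᵢ} L, ∂ⱼ)`. -/
def chi (G : E4 → Matrix (Fin 4) (Fin 4) ℝ) (x : E4) : Matrix (Fin 2) (Fin 2) ℝ :=
  Matrix.of fun i j ↦ ip G x (cov G (coordVec (ang i)) (L G) x) (coordVec (ang j))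

/-- `χ̲ᵢⱼ = g(∇_{∂ᵢ} L̲, ∂ⱼ)`. -/
def chibar (G : E4 → Matrix (Fin 4) (Fin 4) ℝ) (x : E4) : Matrix (Fin 2) (Fin 2) ℝ :=
  Matrix.of fun i j ↦ ip G x (cov G (coordVec (ang i)) (Lbar G) x) (coordVec (ang j))

/-- `ηᵢ = ½ g(∇_{∂ᵢ} L̲, L')`. -/
def eta (G : E4 → Matrix (Fin 4) (Fin 4) ℝ) (x : E4) (i : Fin 2) : ℝ :=
  1 / 2 * ip G x (cov G (coordVec (ang i)) (Lbar G) x) (Lp G x)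

/-- `η̲ᵢ = ½ g(∇_{∂ᵢ} L, L̲')`. -/
def etabar (G : E4 → Matrix (Fin 4) (Fin 4) ℝ) (x : E4) (i : Fin 2) : ℝ :=
  1 / 2 * ip G x (cov G (coordVec (ang i)) (L G) x) (Lbarp G x)

/-- `ω = L log Ω`. -/
def omega (G : E4 → Matrix (Fin 4) (Fin 4) ℝ) (x : E4) : ℝ :=
  ∑ μ, L G x μ * pd μ (fun y ↦ Real.log (Om G y)) x

/-- `ω̲ = L̲ log Ω`. -/
def omegabar (G : E4 → Matrix (Fin 4) (Fin 4) ℝ) (x : E4) : ℝ :=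
  ∑ μ, Lbar G x μ * pd μ (fun y ↦ Real.log (Om G y)) x

/-- `∇̸ᵢ bᵏ`, the covariant derivative of `b` on `Σ_{s,s̲}`; rows are indexed by `i`. -/
def nablab (G : E4 → Matrix (Fin 4) (Fin 4) ℝ) (x : E4) : Matrix (Fin 2) (Fin 2) ℝ :=
  Matrix.of fun i k ↦ pd (ang i) (fun y ↦ b G y k) x + ∑ j, slashGam G x k i j * b G x j

/-- `(∂b/∂s)ᵏ`. -/
def dsb (G : E4 → Matrix (Fin 4) (Fin 4) ℝ) (x : E4) (k : Fin 2) : ℝ :=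
  pd 0 (fun y ↦ b G y k) x

/-! ### The surface `Σ`, the graph of `(f, f̲)` -/

/-- The parametrisation `ϑ ↦ (f(ϑ), f̲(ϑ), ϑ)` of `Σ`, in the coordinates. -/
def graph (f fbar : E2 → ℝ) (t : E2) : E4 := !₂[f t, fbar t, t 0, t 1]

/-- The tangential coordinate frame `∂̇ᵢ = ∂ᵢ + fᵢ ∂_s + f̲ᵢ ∂_s̲` of `Σ`: the `i`-th partial
derivative of the parametrisation. -/
def tang (f fbar : E2 → ℝ) (t : E2) (i : Fin 2) : Fin 4 → ℝ :=
  fun μ ↦ pd i (fun r ↦ graph f fbar r μ) t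

/-- The intrinsic metric of `Σ`. -/
def dotg (G : E4 → Matrix (Fin 4) (Fin 4) ℝ) (f fbar : E2 → ℝ) (t : E2) :
    Matrix (Fin 2) (Fin 2) ℝ :=
  Matrix.of fun i j ↦ ip G (graph f fbar t) (tang f fbar t i) (tang f fbar t j)

/-- `∇_{∂̇ᵢ} V` for a vector field `V` along `Σ`. -/
def covAlong (G : E4 → Matrix (Fin 4) (Fin 4) ℝ) (f fbar : E2 → ℝ) (i : Fin 2)
    (V : E2 → Fin 4 → ℝ) (t : E2) : Fin 4 → ℝ :=
  fun μ ↦ pd i (fun r ↦ V r μ) t +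
    ∑ α, ∑ β, Gam G (graph f fbar t) μ α β * tang f fbar t i α * V t β

/-- The matrix `Bᵢʲ = δᵢʲ - fᵢ bʲ`; rows are indexed by the lower index. -/
def B (G : E4 → Matrix (Fin 4) (Fin 4) ℝ) (f fbar : E2 → ℝ) (t : E2) :
    Matrix (Fin 2) (Fin 2) ℝ :=
  Matrix.of fun i j ↦ (if i = j then 1 else 0) - pd i f t * b G (graph f fbar t) j

/-- `-2Ω² hᵢ (B⁻¹)ⱼⁱ (g̸⁻¹)ʲᵏ`, which is `eᵏ` for `h = f` and `e̲ᵏ` for `h = f̲`. -/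
def eAux (G : E4 → Matrix (Fin 4) (Fin 4) ℝ) (f fbar h : E2 → ℝ) (t : E2) (k : Fin 2) : ℝ :=
  -2 * (Om G (graph f fbar t)) ^ 2 *
    ∑ i, ∑ j, pd i h t * (B G f fbar t)⁻¹ j i * (slashg G (graph f fbar t))⁻¹ j k

/-- The inner product of two angular vectors with respect to `g̸` at the point of `Σ` over `t`. -/
def sdot (G : E4 → Matrix (Fin 4) (Fin 4) ℝ) (f fbar : E2 → ℝ) (t : E2) (v w : Fin 2 → ℝ) : ℝ :=
  v ⬝ᵥ (slashg G (graph f fbar t) *ᵥ w)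

/-- `(2Ω² + e·e̲) + √((2Ω² + e·e̲)² - |e|²|e̲|²)`. -/
def epsDen (G : E4 → Matrix (Fin 4) (Fin 4) ℝ) (f fbar : E2 → ℝ) (t : E2) : ℝ :=
  let e := eAux G f fbar f t
  let ebar := eAux G f fbar fbar t
  let X := 2 * (Om G (graph f fbar t)) ^ 2 + sdot G f fbar t e ebar
  X + Real.sqrt (X ^ 2 - sdot G f fbar t e e * sdot G f fbar t ebar ebar)

/-- The function `ε`. -/
def eps (G : E4 → Matrix (Fin 4) (Fin 4) ℝ) (f fbar : E2 → ℝ) (t : E2) : ℝ :=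
  -sdot G f fbar t (eAux G f fbar f t) (eAux G f fbar f t) / epsDen G f fbar t

/-- The function `ε̲`. -/
def epsbar (G : E4 → Matrix (Fin 4) (Fin 4) ℝ) (f fbar : E2 → ℝ) (t : E2) : ℝ :=
  -sdot G f fbar t (eAux G f fbar fbar t) (eAux G f fbar fbar t) / epsDen G f fbar t

/-- The components `εᵏ = eᵏ + ε e̲ᵏ`. -/
def epsVec (G : E4 → Matrix (Fin 4) (Fin 4) ℝ) (f fbar : E2 → ℝ) (t : E2) : Fin 2 → ℝ :=
  eAux G f fbar f t + eps G f fbar t • eAux G f fbar fbar t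

/-- The components `ε̲ᵏ = e̲ᵏ + ε̲ eᵏ`. -/
def epsbarVec (G : E4 → Matrix (Fin 4) (Fin 4) ℝ) (f fbar : E2 → ℝ) (t : E2) : Fin 2 → ℝ :=
  eAux G f fbar fbar t + epsbar G f fbar t • eAux G f fbar f t

/-- `L̇ = L + ε L̲ + εⁱ ∂ᵢ`. -/
def dotL (G : E4 → Matrix (Fin 4) (Fin 4) ℝ) (f fbar : E2 → ℝ) (t : E2) : Fin 4 → ℝ :=
  L G (graph f fbar t) + eps G f fbar t • Lbar G (graph f fbar t) +
    ∑ i, epsVec G f fbar t i • coordVec (ang i)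

/-- `L̲̇ = L̲ + ε̲ L + ε̲ⁱ ∂ᵢ`. -/
def dotLbar (G : E4 → Matrix (Fin 4) (Fin 4) ℝ) (f fbar : E2 → ℝ) (t : E2) : Fin 4 → ℝ :=
  Lbar G (graph f fbar t) + epsbar G f fbar t • L G (graph f fbar t) +
    ∑ i, epsbarVec G f fbar t i • coordVec (ang i)

/-- `Ω̇²`, where `2Ω̇² = g(L̲̇, L̇)`. -/
def dotOmSq (G : E4 → Matrix (Fin 4) (Fin 4) ℝ) (f fbar : E2 → ℝ) (t : E2) : ℝ :=
  1 / 2 * ip G (graph f fbar t) (dotLbar G f fbar t) (dotL G f fbar t)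

/-- `L̇' = Ω̇⁻² L̇`. -/
def dotLp (G : E4 → Matrix (Fin 4) (Fin 4) ℝ) (f fbar : E2 → ℝ) (t : E2) : Fin 4 → ℝ :=
  (dotOmSq G f fbar t)⁻¹ • dotL G f fbar t

/-- The null second fundamental form `χ̇ᵢⱼ = g(∇_{∂̇ᵢ} L̇, ∂̇ⱼ)` of `Σ`. -/
def dotChi (G : E4 → Matrix (Fin 4) (Fin 4) ℝ) (f fbar : E2 → ℝ) (t : E2) (i j : Fin 2) : ℝ :=
  ip G (graph f fbar t) (covAlong G f fbar i (dotL G f fbar) t) (tang f fbar t j)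

/-- The null second fundamental form `χ̲̇ᵢⱼ = g(∇_{∂̇ᵢ} L̲̇, ∂̇ⱼ)` of `Σ`. -/
def dotChibar (G : E4 → Matrix (Fin 4) (Fin 4) ℝ) (f fbar : E2 → ℝ) (t : E2) (i j : Fin 2) : ℝ :=
  ip G (graph f fbar t) (covAlong G f fbar i (dotLbar G f fbar) t) (tang f fbar t j)

/-- The torsion `η̇ᵢ = ½ g(∇_{∂̇ᵢ} L̲̇, L̇')` of `Σ`. -/
def dotEta (G : E4 → Matrix (Fin 4) (Fin 4) ℝ) (f fbar : E2 → ℝ) (t : E2) (i : Fin 2) : ℝ :=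
  1 / 2 * ip G (graph f fbar t) (covAlong G f fbar i (dotLbar G f fbar) t) (dotLp G f fbar t)

/-- `Σ`, the graph of `(f, f̲)` over the open set `V`, is a smooth spacelike surface in the domain
`U` of the coordinates. -/
structure IsSpacelikeGraph (G : E4 → Matrix (Fin 4) (Fin 4) ℝ) (U : Set E4)
    (V : Set E2) (f fbar : E2 → ℝ) : Prop where
  isOpen : IsOpen V
  smooth : ContDiffOn ℝ ∞ f V
  smooth_bar : ContDiffOn ℝ ∞ fbar V
  mem : ∀ t ∈ V, graph f fbar t ∈ U
  spacelike : ∀ t ∈ V, (dotg G f fbar t).PosDef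

/-- `∇̸²ᵢⱼ h`, the pulled back second covariant derivative of a function `h` on `Σ`. -/
def hess (G : E4 → Matrix (Fin 4) (Fin 4) ℝ) (f fbar h : E2 → ℝ) (t : E2) (i j : Fin 2) : ℝ :=
  pd i (pd j h) t - ∑ k, slashGam G (graph f fbar t) k i j * pd k h t

/-- `(∇̸ᵢ V)ᵏ`, the pulled back covariant derivative of a field `Vᵏ` on `Σ`. -/
def nablaVec (G : E4 → Matrix (Fin 4) (Fin 4) ℝ) (f fbar : E2 → ℝ) (V : E2 → Fin 2 → ℝ) (t : E2)
    (i : Fin 2) : Fin 2 → ℝ :=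
  fun k ↦ pd i (fun r ↦ V r k) t + ∑ j, slashGam G (graph f fbar t) k i j * V t j

/-- `sym(P ⊗ Q)ᵢⱼ = ½ (Pᵢ Qⱼ + Pⱼ Qᵢ)`. -/
def sym (P Q : Fin 2 → ℝ) (i j : Fin 2) : ℝ := 1 / 2 * (P i * Q j + P j * Q i)

end DoubleNull

end

noncomputable section

namespace DoubleNull

/-! The eikonal equations and the transport condition force the coordinate form `g = 2Ω²(ds ⊗ ds̲ +
ds̲ ⊗ ds) + g̸ᵢⱼ(dθⁱ - bⁱds) ⊗ (dθʲ - bʲds)`, with `L = ∂_s̲` and `L̲ = ∂_s + b`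
(`IsDoubleNullAt.eq_normalForm`). Hence the lowered Christoffel symbols and all structure
coefficients are polynomial in `b`, `g̸` and the first derivatives of `Ω²`, `b`, `g̸`, once `η, η̲,
ω, ω̲` are multiplied by `2Ω²` (`IsDoubleNullOn.structureRelations`). The claim then reduces to two
polynomial identities, `christoffelForm_tangent_tangent` and `christoffelForm_tangent_normal`.

Null frame: `e` and `e̲` are chosen so that `L + eᵏ∂ₖ` and `L̲ + e̲ᵏ∂ₖ` are normal to the surface.
Their squared lengths are `|e|²` and `|e̲|²`, and their product is `X = 2Ω² + e·e̲`. So `L̇`, the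
first plus `ε` times the second, is null exactly when `|e|² + 2εX + ε²|e̲|² = 0`, and symmetrically
for `L̲̇`. The roots are real because the surface is spacelike: this gives `X > 0` and `|e|²|e̲|² <
X²` (`gap_of_posDef`, `eAux_gap`).

Second fundamental forms: a normal field `N` satisfies `g(∇ᵢN, ∂̇ⱼ) = -g(N, ∇ᵢ∂̇ⱼ)`, so derivatives
of `ε` and `ε̲` never enter. The right side is linear in `N = pL̲ + qL + vᵏ∂ₖ`, and one formula,
`secondForm_eq`, serves both normals. Orthogonality writes the lowered `v` as a combination of `df`,
`df̲` and so turns the Christoffel symbols of `g̸` into those of the two Hessians.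

Torsion: both vectors are normal, so `L̲̇` itself is differentiated, which leaves the terms in
`∂̇ᵢε̲` and `∇̸ᵢε̲ᵏ` (`torsion_eq`). -/

theorem pd_coord {n : ℕ} (μ ν : Fin n) (x : EuclideanSpace ℝ (Fin n)) :
    pd μ (fun y ↦ y ν) x = if μ = ν then 1 else 0 := by
  have h : HasFDerivAt (fun y : EuclideanSpace ℝ (Fin n) ↦ y ν)
      (EuclideanSpace.proj ν : EuclideanSpace ℝ (Fin n) →L[ℝ] ℝ) x :=
    (EuclideanSpace.proj ν : EuclideanSpace ℝ (Fin n) →L[ℝ] ℝ).hasFDerivAt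
  simp [pd, h.fderiv, eq_comm]

/-! ### Lorentzian linear algebra at a point -/

theorem ip_add_left (G : E4 → Matrix (Fin 4) (Fin 4) ℝ) (x : E4) (u v w : Fin 4 → ℝ) :
    ip G x (u + v) w = ip G x u w + ip G x v w := by
  simp [ip, add_dotProduct]

theorem ip_smul_left (G : E4 → Matrix (Fin 4) (Fin 4) ℝ) (x : E4) (c : ℝ) (v w : Fin 4 → ℝ) :
    ip G x (c • v) w = c * ip G x v w := by
  simp [ip, smul_dotProduct]

theorem ip_add_right (G : E4 → Matrix (Fin 4) (Fin 4) ℝ) (x : E4) (u v w : Fin 4 → ℝ) :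
    ip G x w (u + v) = ip G x w u + ip G x w v := by
  simp [ip, Matrix.mulVec_add, dotProduct_add]

theorem ip_smul_right (G : E4 → Matrix (Fin 4) (Fin 4) ℝ) (x : E4) (c : ℝ) (v w : Fin 4 → ℝ) :
    ip G x w (c • v) = c * ip G x w v := by
  simp [ip, Matrix.mulVec_smul, dotProduct_smul]

theorem ip_comm {G : E4 → Matrix (Fin 4) (Fin 4) ℝ} {x : E4} (hs : (G x).IsSymm)
    (v w : Fin 4 → ℝ) : ip G x v w = ip G x w v := by
  rw [ip, ip, Matrix.dotProduct_mulVec, dotProduct_comm, ← Matrix.mulVec_transpose, hs.eq]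

/-- The bilinear form at `x` is Lorentzian: it is negative on some vector and positive definite on
the orthogonal complement of that vector. -/
def IsLorentz (G : E4 → Matrix (Fin 4) (Fin 4) ℝ) (x : E4) : Prop :=
  ∃ v, ip G x v v < 0 ∧ ∀ w, ip G x v w = 0 → w ≠ 0 → 0 < ip G x w w

/-- A kernel vector would be orthogonal to the timelike vector, hence of positive length, although
its length is zero. -/
theorem IsLorentz.isUnit_det {G : E4 → Matrix (Fin 4) (Fin 4) ℝ} {x : E4} (h : IsLorentz G x) :
    IsUnit (G x).det := by
  obtain ⟨v, -, hv⟩ := h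
  rw [isUnit_iff_ne_zero]
  intro hdet
  obtain ⟨w, hw0, hw⟩ := Matrix.exists_mulVec_eq_zero_iff.2 hdet
  have := hv w (by simp [ip, hw]) hw0
  simp [ip, hw] at this

/-- A vector orthogonal to a timelike vector is spacelike. -/
theorem IsLorentz.pos_of_orthogonal {G : E4 → Matrix (Fin 4) (Fin 4) ℝ} {x : E4}
    (hs : (G x).IsSymm) (h : IsLorentz G x) {T w : Fin 4 → ℝ} (hT : ip G x T T < 0)
    (hTw : ip G x T w = 0) (hw : w ≠ 0) : 0 < ip G x w w := by
  obtain ⟨v, -, hv⟩ := h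
  have hT0 : T ≠ 0 := by
    rintro rfl
    simp [ip] at hT
  have hβ : ip G x v T ≠ 0 := fun h0 ↦ (hv T h0 hT0).not_gt hT
  set α := ip G x v w
  set β := ip G x v T
  -- This combination is orthogonal to `v`, so it has positive length. As `T ⊥ w`, that length is
  -- `α² g(T,T) + β² g(w,w)`, whose first term is nonpositive.
  have hu0 : α • T + (-β) • w ≠ 0 := by
    intro hu
    have h1 : ip G x T (α • T + (-β) • w) = 0 := by rw [hu]; simp [ip]
    rw [ip_add_right, ip_smul_right, ip_smul_right, hTw, mul_zero, add_zero] at h1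
    have hα : α = 0 := (mul_eq_zero.1 h1).resolve_right hT.ne
    rw [hα, zero_smul, zero_add] at hu
    exact (smul_ne_zero (neg_ne_zero.2 hβ) hw) hu
  have h2 := hv (α • T + (-β) • w) (by
    rw [ip_add_right, ip_smul_right, ip_smul_right]; simp only [α, β]; ring) hu0
  have h3 : ip G x (α • T + (-β) • w) (α • T + (-β) • w)
      = α ^ 2 * ip G x T T + β ^ 2 * ip G x w w := by
    simp only [ip_add_right, ip_smul_right, ip_add_left, ip_smul_left, hTw, ip_comm hs w T]
    ring
  rw [h3] at h2
  have h4 : 0 < β ^ 2 * ip G x w w := by nlinarith [sq_nonneg α]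
  exact pos_of_mul_pos_right h4 (sq_nonneg β)

/-- The hypotheses on the metric components at a single point. -/
structure IsDoubleNullAt (G : E4 → Matrix (Fin 4) (Fin 4) ℝ) (x : E4) : Prop where
  symm : (G x).IsSymm
  lorentz : IsLorentz G x
  eikonal : ip G x (grad G (fun y ↦ y 0) x) (grad G (fun y ↦ y 0) x) = 0
  eikonal_bar : ip G x (grad G (fun y ↦ y 1) x) (grad G (fun y ↦ y 1) x) = 0
  pos : 0 < ip G x (Lp G x) (Lbarp G x)
  transport : ∀ i : Fin 2, L G x (ang i) = 0

theorem ip_grad {G : E4 → Matrix (Fin 4) (Fin 4) ℝ} {x : E4} (h : IsUnit (G x).det)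
    (v : Fin 4 → ℝ) (μ : Fin 4) : ip G x v (grad G (fun y ↦ y μ) x) = v μ := by
  rw [ip, grad, Matrix.mulVec_mulVec, Matrix.mul_nonsing_inv _ h, Matrix.one_mulVec]
  simp [pd_coord, dotProduct]

/-! ### The double null conditions at a point and the normal form of the metric -/

namespace IsDoubleNullAt

variable {G : E4 → Matrix (Fin 4) (Fin 4) ℝ} {x : E4}

theorem om_sq_eq (h : IsDoubleNullAt G x) :
    Om G x ^ 2 = 2 / ip G x (Lp G x) (Lbarp G x) :=
  Real.sq_sqrt (div_pos two_pos h.pos).le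

theorem om_pos (h : IsDoubleNullAt G x) : 0 < Om G x :=
  Real.sqrt_pos.2 (div_pos two_pos h.pos)

theorem om_sq_pos (h : IsDoubleNullAt G x) : 0 < Om G x ^ 2 := pow_pos h.om_pos 2

/-- `g(v, L) = 2Ω² v(s)`. -/
theorem ip_L (h : IsDoubleNullAt G x) (v : Fin 4 → ℝ) :
    ip G x v (L G x) = 2 * Om G x ^ 2 * v 0 := by
  rw [L, Lp, ip_smul_right, ip_smul_right, ip_grad h.lorentz.isUnit_det]; ring

/-- `g(v, L̲) = 2Ω² v(s̲)`. -/
theorem ip_Lbar (h : IsDoubleNullAt G x) (v : Fin 4 → ℝ) :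
    ip G x v (Lbar G x) = 2 * Om G x ^ 2 * v 1 := by
  rw [Lbar, Lbarp, ip_smul_right, ip_smul_right, ip_grad h.lorentz.isUnit_det]; ring

theorem L_one (h : IsDoubleNullAt G x) : L G x 1 = 1 := by
  have h1 : ip G x (Lp G x) (Lbarp G x) = 2 * Lp G x 1 := by
    rw [Lbarp, ip_smul_right, ip_grad h.lorentz.isUnit_det]
  have h2 := h.om_sq_eq
  have h3 := h.pos
  rw [h1] at h2 h3
  have h4 : Lp G x 1 ≠ 0 := by linarith
  simp only [L, Pi.smul_apply, smul_eq_mul, h2]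
  field_simp

theorem L_zero (h : IsDoubleNullAt G x) : L G x 0 = 0 := by
  have h1 := h.eikonal
  rw [ip_grad h.lorentz.isUnit_det] at h1
  simp [L, Lp, h1]

theorem Lbar_one (h : IsDoubleNullAt G x) : Lbar G x 1 = 0 := by
  have h1 := h.eikonal_bar
  rw [ip_grad h.lorentz.isUnit_det] at h1
  simp [Lbar, Lbarp, h1]

/-- By symmetry of `g`, evaluating `g(L̲, L)` as `2Ω² L̲(s)` and as `2Ω² L(s̲)` gives the same
number. -/
theorem Lbar_zero (h : IsDoubleNullAt G x) : Lbar G x 0 = 1 := by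
  have h1 := h.ip_L (Lbar G x)
  rw [ip_comm h.symm, h.ip_Lbar, h.L_one] at h1
  exact (mul_left_cancel₀ (mul_pos two_pos h.om_sq_pos).ne' h1).symm

theorem L_eq (h : IsDoubleNullAt G x) : L G x = ![0, 1, 0, 0] := by
  have h2 := h.transport 0
  have h3 := h.transport 1
  ext μ
  fin_cases μ
  exacts [h.L_zero, h.L_one, h2, h3]

theorem Lbar_eq (h : IsDoubleNullAt G x) : Lbar G x = ![1, 0, b G x 0, b G x 1] := by
  ext μ
  fin_cases μ
  · exact h.Lbar_zero
  · exact h.Lbar_one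
  · simp [b, ang, coordVec]
  · simp [b, ang, coordVec]

theorem ip_coordVec (v : Fin 4 → ℝ) (μ : Fin 4) : ip G x (coordVec μ) v = (G x *ᵥ v) μ := by
  simp [ip, coordVec]

theorem slashg_apply (i j : Fin 2) : slashg G x i j = G x (ang i) (ang j) := by
  simp [slashg, ip, coordVec]

theorem slashg_symm (h : IsDoubleNullAt G x) (i j : Fin 2) :
    slashg G x i j = slashg G x j i := by
  rw [slashg_apply, slashg_apply, h.symm.apply]

/-- The shape of the metric: `g = 2Ω² (ds ⊗ ds̲ + ds̲ ⊗ ds) + g̸ᵢⱼ (dθⁱ - bⁱ ds) ⊗ (dθʲ - bʲ ds)`. -/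
theorem eq_normalForm (h : IsDoubleNullAt G x) :
    G x = !![∑ i, ∑ j, slashg G x i j * b G x i * b G x j, 2 * Om G x ^ 2,
        -∑ j, slashg G x 0 j * b G x j, -∑ j, slashg G x 1 j * b G x j;
      2 * Om G x ^ 2, 0, 0, 0;
      -∑ j, slashg G x 0 j * b G x j, 0, slashg G x 0 0, slashg G x 0 1;
      -∑ j, slashg G x 1 j * b G x j, 0, slashg G x 1 0, slashg G x 1 1] := by
  -- Pairing `∂_μ` with `L = ∂_s̲` gives the column of `s̲`; pairing with `L̲ = ∂_s + b` then gives
  -- the column of `s` from the angular ones.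
  have hL : ∀ μ, G x μ 1 = 2 * Om G x ^ 2 * coordVec μ 0 := by
    intro μ
    rw [← h.ip_L, ip_coordVec, h.L_eq]
    simp [Matrix.mulVec, dotProduct, Fin.sum_univ_four]
  have hLb : ∀ μ, G x μ 0 + G x μ 2 * b G x 0 + G x μ 3 * b G x 1
      = 2 * Om G x ^ 2 * coordVec μ 1 := by
    intro μ
    rw [← h.ip_Lbar, ip_coordVec, h.Lbar_eq]
    simp [Matrix.mulVec, dotProduct, Fin.sum_univ_four]
  have hs : ∀ μ ν, G x μ ν = G x ν μ := fun μ ν ↦ h.symm.apply ν μ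
  have l0 := hL 0
  have l1 := hL 1
  have l2 := hL 2
  have l3 := hL 3
  have m0 := hLb 0
  have m2 := hLb 2
  have m3 := hLb 3
  have s20 := hs 2 0
  have s30 := hs 3 0
  have s32 := hs 3 2
  have s10 := hs 1 0
  have s12 := hs 1 2
  have s13 := hs 1 3
  simp [coordVec] at l0 l1 l2 l3 m0 m2 m3
  simp only [slashg_apply, Fin.sum_univ_two, ang, Matrix.cons_val_zero, Matrix.cons_val_one]
  ext μ ν
  fin_cases μ <;> fin_cases ν <;> simp <;>
    first | linear_combination l0 | linear_combination m2 | linear_combination m3 |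
      linear_combination l1 | linear_combination l2 | linear_combination l3 |
      linear_combination s10 + l0 | linear_combination s12 + l2 | linear_combination s13 + l3 |
      linear_combination m2 - s20 | linear_combination m3 - s30 |
      linear_combination m0 - b G x 0 * m2 - b G x 1 * m3 + b G x 0 * s20 + b G x 1 * s30

/-- `L - L̲` is timelike, of square `-4Ω²`, and angular vectors are orthogonal to it because they
annihilate both `s` and `s̲`. -/
theorem slashg_posDef (h : IsDoubleNullAt G x) : (slashg G x).PosDef := by
  refine Matrix.PosDef.of_dotProduct_mulVec_pos ?_ ?_
  · ext i j
    simp [h.slashg_symm]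
  intro v hv
  have hT : ip G x (L G x - Lbar G x) (L G x - Lbar G x) < 0 := by
    have h1 : L G x - Lbar G x = L G x + (-1 : ℝ) • Lbar G x := by simp [sub_eq_add_neg]
    have h2 : ip G x (L G x - Lbar G x) (L G x - Lbar G x) = -4 * Om G x ^ 2 := by
      conv_lhs => rw [h1]
      rw [ip_add_right, ip_smul_right, ip_add_left, ip_smul_left, ip_add_left, ip_smul_left,
        h.ip_L, h.ip_L, h.ip_Lbar, h.ip_Lbar, h.L_zero, h.L_one, h.Lbar_zero, h.Lbar_one]
      ring
    rw [h2]
    linarith [h.om_sq_pos]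
  have hw : ip G x (L G x - Lbar G x) ![0, 0, v 0, v 1] = 0 := by
    have h1 : L G x - Lbar G x = L G x + (-1 : ℝ) • Lbar G x := by simp [sub_eq_add_neg]
    rw [h1, ip_add_left, ip_smul_left, ip_comm h.symm, ip_comm h.symm (Lbar G x), h.ip_L,
      h.ip_Lbar]
    simp
  have hw0 : (![0, 0, v 0, v 1] : Fin 4 → ℝ) ≠ 0 := by
    intro h0
    apply hv
    ext i
    fin_cases i
    · simpa using congrFun h0 2
    · simpa using congrFun h0 3
  have := h.lorentz.pos_of_orthogonal h.symm hT hw hw0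
  simpa [ip, dotProduct, Matrix.mulVec, Fin.sum_univ_four, Fin.sum_univ_two, slashg_apply,
    ang] using this

end IsDoubleNullAt

/-! ### The metric components in the chart -/

section Manifold

theorem contMDiffAt_chart_symm {M : Type*} [TopologicalSpace M] [ChartedSpace E4 M]
    {φ : OpenPartialHomeomorph M E4}
    (hφ : φ ∈ IsManifold.maximalAtlas (𝓡 4) ∞ M) {x : E4} (hx : x ∈ φ.target) :
    ContMDiffAt 𝓘(ℝ, E4) (𝓡 4) ∞ φ.symm x :=
  (contMDiffOn_symm_of_mem_maximalAtlas hφ).contMDiffAt (φ.open_target.mem_nhds hx)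

variable {M : Type*} [TopologicalSpace M] [ChartedSpace E4 M] [IsManifold (𝓡 4) ∞ M]

theorem contMDiffAt_coordinate_field {φ : OpenPartialHomeomorph M E4}
    (hφ : φ ∈ IsManifold.maximalAtlas (𝓡 4) ∞ M) {x : E4} (hx : x ∈ φ.target) (v : E4) :
    ContMDiffAt 𝓘(ℝ, E4) ((𝓡 4).prod 𝓘(ℝ, E4)) ∞
      (fun y ↦ Bundle.TotalSpace.mk' E4 (E := fun p : M ↦ TangentSpace (𝓡 4) p) (φ.symm y)
        (mfderiv 𝓘(ℝ, E4) (𝓡 4) φ.symm y v)) x := by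
  have h1 := contMDiffAt_chart_symm hφ hx
  have h2 : ContMDiffAt 𝓘(ℝ, E4) (𝓘(ℝ, E4).prod 𝓘(ℝ, E4)) ∞
      (fun y ↦ Bundle.TotalSpace.mk' E4 (E := fun p : E4 ↦ TangentSpace 𝓘(ℝ, E4) p) y v) x :=
    contMDiffAt_vectorSpace_iff_contDiffAt.2 contDiffAt_const
  exact ContMDiffAt.clm_apply_of_inCoordinates (h1.mfderiv_const (m := ∞) (by simp)) h2 h1

theorem LorentzMetric.contDiffAt_comp (g : LorentzMetric M) {φ : OpenPartialHomeomorph M E4}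
    (hφ : φ ∈ IsManifold.maximalAtlas (𝓡 4) ∞ M) {x : E4} (hx : x ∈ φ.target) (μ ν : Fin 4) :
    ContDiffAt ℝ ∞ (fun y ↦ g.comp φ y μ ν) x := by
  have h1 := contMDiffAt_chart_symm hφ hx
  have hg : ContMDiffAt 𝓘(ℝ, E4) ((𝓡 4).prod 𝓘(ℝ, E4 →L[ℝ] E4 →L[ℝ] ℝ)) ∞
    (fun y ↦ Bundle.TotalSpace.mk' (E4 →L[ℝ] E4 →L[ℝ] ℝ)
      (E := fun p : M ↦ (TangentSpace (𝓡 4) p →L[ℝ] TangentSpace (𝓡 4) p →L[ℝ] ℝ)) (φ.symm y)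
        (g.val (φ.symm y))) x :=
    ContMDiffAt.comp x g.smooth.contMDiffAt h1
  have : ContMDiffAt 𝓘(ℝ, E4) ((𝓡 4).prod 𝓘(ℝ)) ∞
      (fun y ↦ Bundle.TotalSpace.mk' ℝ (E := Bundle.Trivial M ℝ) (φ.symm y)
        (g.val (φ.symm y) (mfderiv 𝓘(ℝ, E4) (𝓡 4) φ.symm y (EuclideanSpace.single μ (1 : ℝ) : E4))
    (mfderiv 𝓘(ℝ, E4) (𝓡 4) φ.symm y (EuclideanSpace.single ν (1 : ℝ) : E4)))) x := by
    apply ContMDiffAt.clm_bundle_apply₂ (F₁ := E4) (F₂ := E4)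
    · exact hg
    · exact contMDiffAt_coordinate_field hφ hx _
    · exact contMDiffAt_coordinate_field hφ hx _
  simp only [Bundle.contMDiffAt_totalSpace] at this
  exact contMDiffAt_iff_contDiffAt.1 this.2

theorem LorentzMetric.comp_symm (g : LorentzMetric M) (φ : OpenPartialHomeomorph M E4) (x : E4) :
    (g.comp φ x).IsSymm := by
  ext μ ν
  exact g.symm _ _ _

theorem LorentzMetric.ip_comp (g : LorentzMetric M) (φ : OpenPartialHomeomorph M E4) (x : E4)
    (v w : Fin 4 → ℝ) :
    ip (g.comp φ) x v w = g.val (φ.symm x)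
      (mfderiv 𝓘(ℝ, E4) (𝓡 4) φ.symm x (WithLp.toLp 2 v : E4))
      (mfderiv 𝓘(ℝ, E4) (𝓡 4) φ.symm x (WithLp.toLp 2 w : E4)) := by
  have h : ∀ v : Fin 4 → ℝ, (WithLp.toLp 2 v : E4) = ∑ μ, v μ • EuclideanSpace.single μ (1 : ℝ) := by
    intro v
    ext ν
    simp [Finset.sum_apply, Pi.single_apply]
  have hA : ∀ v : Fin 4 → ℝ, mfderiv 𝓘(ℝ, E4) (𝓡 4) φ.symm x (WithLp.toLp 2 v : E4)
      = ∑ μ, v μ • mfderiv 𝓘(ℝ, E4) (𝓡 4) φ.symm x (EuclideanSpace.single μ (1 : ℝ) : E4) := by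
    intro v
    rw [h v]
    refine (map_sum _ _ _).trans (Finset.sum_congr rfl fun μ _ ↦ ?_)
    exact map_smul _ _ _
  rw [hA v, hA w]
  simp only [ip, dotProduct, Matrix.mulVec, LorentzMetric.comp, Matrix.of_apply, map_sum, map_smul,
    sum_apply, smul_apply, smul_eq_mul]
  simp only [Finset.mul_sum]
  rw [Finset.sum_comm]
  refine Finset.sum_congr rfl fun μ _ ↦ ?_
  refine Finset.sum_congr rfl fun ν _ ↦ ?_
  ring

/-- The differential of the inverse chart is bijective: surjectivity pulls the timelike vector back
to coordinates, and injectivity keeps nonzero vectors nonzero. -/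
theorem LorentzMetric.isLorentz_comp (g : LorentzMetric M) {φ : OpenPartialHomeomorph M E4}
    (hφ : φ ∈ IsManifold.maximalAtlas (𝓡 4) ∞ M) {x : E4} (hx : x ∈ φ.target) :
    IsLorentz (g.comp φ) x := by
  have hd : φ.symm.MDifferentiable 𝓘(ℝ, E4) (𝓡 4) :=
    ⟨(contMDiffOn_symm_of_mem_maximalAtlas hφ).mdifferentiableOn (by simp),
      (contMDiffOn_of_mem_maximalAtlas hφ).mdifferentiableOn (by simp)⟩
  obtain ⟨v, hv, hpos⟩ := g.lorentz (φ.symm x)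
  obtain ⟨v', hv'⟩ := hd.mfderiv_surjective (x := x) hx v
  have hv'' : mfderiv 𝓘(ℝ, E4) (𝓡 4) φ.symm x (WithLp.toLp 2 (WithLp.ofLp (v' : E4)) : E4) = v :=
    hv'
  refine ⟨WithLp.ofLp (v' : E4), ?_, fun w hw hw0 ↦ ?_⟩
  · rw [g.ip_comp, hv'']
    exact hv
  · rw [g.ip_comp, hv''] at hw
    rw [g.ip_comp]
    refine hpos _ hw fun h0 ↦ hw0 ?_
    have h1 : (WithLp.toLp 2 w : E4) = 0 :=
      hd.mfderiv_injective (x := x) hx (h0.trans (map_zero _).symm)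
    simpa using congrArg WithLp.ofLp h1

theorem IsDoubleNull.isDoubleNullAt {g : LorentzMetric M} {φ : OpenPartialHomeomorph M E4}
    (h : IsDoubleNull g φ) {x : E4} (hx : x ∈ φ.target) : IsDoubleNullAt (g.comp φ) x where
  symm := g.comp_symm φ x
  lorentz := g.isLorentz_comp h.chart hx
  eikonal := h.eikonal x hx
  eikonal_bar := h.eikonal_bar x hx
  pos := h.pos x hx
  transport := h.transport x hx

end Manifold

/-! ### Rules for partial derivatives -/

section PartialDerivatives

variable {n : ℕ} {i : Fin n} {x : EuclideanSpace ℝ (Fin n)} {h k : EuclideanSpace ℝ (Fin n) → ℝ}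

theorem pd_congr (hhk : h =ᶠ[nhds x] k) : pd i h x = pd i k x := by
  rw [pd, pd, hhk.fderiv_eq]

theorem pd_const (c : ℝ) : pd i (fun _ ↦ c) x = 0 := by
  simp [pd]

theorem pd_add (hh : DifferentiableAt ℝ h x) (hk : DifferentiableAt ℝ k x) :
    pd i (fun y ↦ h y + k y) x = pd i h x + pd i k x := by
  simp [pd, fderiv_fun_add hh hk]

theorem pd_sub (hh : DifferentiableAt ℝ h x) (hk : DifferentiableAt ℝ k x) :
    pd i (fun y ↦ h y - k y) x = pd i h x - pd i k x := by
  simp [pd, fderiv_fun_sub hh hk]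

theorem pd_mul (hh : DifferentiableAt ℝ h x) (hk : DifferentiableAt ℝ k x) :
    pd i (fun y ↦ h y * k y) x = pd i h x * k x + h x * pd i k x := by
  simp [pd, fderiv_fun_mul hh hk]
  ring

theorem pd_const_mul (c : ℝ) (hh : DifferentiableAt ℝ h x) :
    pd i (fun y ↦ c * h y) x = c * pd i h x := by
  simp [pd, fderiv_const_mul hh c]

theorem pd_sum {ι : Type*} (s : Finset ι) {h : ι → EuclideanSpace ℝ (Fin n) → ℝ}
    (hh : ∀ a ∈ s, DifferentiableAt ℝ (h a) x) :
    pd i (fun y ↦ ∑ a ∈ s, h a y) x = ∑ a ∈ s, pd i (h a) x := by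
  simp [pd, fderiv_fun_sum hh]

end PartialDerivatives

/-! ### Christoffel symbols with lowered index -/

/-- The derivative of `h` at `x` in the direction `X`. -/
def dirD (X : Fin 4 → ℝ) (h : E4 → ℝ) (x : E4) : ℝ := ∑ α, X α * pd α h x

theorem fderiv_eq_dirD (h : E4 → ℝ) (x : E4) (v : E4) : fderiv ℝ h x v = dirD (fun α ↦ v α) h x := by
  have hv : v = ∑ α, v α • EuclideanSpace.single α (1 : ℝ) := by
    ext ν
    simp [Finset.sum_apply, Pi.single_apply]
  conv_lhs => rw [hv]
  simp [dirD, pd, map_sum]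

theorem ip_eq_sum (G : E4 → Matrix (Fin 4) (Fin 4) ℝ) (x : E4) (v w : Fin 4 → ℝ) :
    ip G x v w = ∑ μ, ∑ ν, v μ * G x μ ν * w ν := by
  simp only [ip, dotProduct, Matrix.mulVec, Finset.mul_sum, mul_assoc]

theorem sum_mul_christoffel {n : ℕ} {g : Matrix (Fin n) (Fin n) ℝ} (hg : IsUnit g.det)
    (dg : Fin n → Fin n → Fin n → ℝ) (l i j : Fin n) :
    ∑ k, g l k * christoffel g dg k i j = 1 / 2 * (dg i l j + dg j l i - dg l i j) := by
  have h : ∀ m, ∑ k, g l k * g⁻¹ k m = if l = m then 1 else 0 := by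
    intro m
    rw [← Matrix.mul_apply, Matrix.mul_nonsing_inv _ hg, Matrix.one_apply]
  calc ∑ k, g l k * christoffel g dg k i j
      = 1 / 2 * ∑ m, (∑ k, g l k * g⁻¹ k m) * (dg i m j + dg j m i - dg m i j) := by
        simp only [christoffel, Finset.mul_sum, Finset.sum_mul]
        rw [Finset.sum_comm]
        exact Finset.sum_congr rfl fun m _ ↦ Finset.sum_congr rfl fun k _ ↦ by ring
    _ = _ := by simp [h]

/-- `g(Γ(X, Y), W)`, where `Γ(X, Y)^μ = Γ^μ_{αβ} X^α Y^β`. -/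
def ipGam (G : E4 → Matrix (Fin 4) (Fin 4) ℝ) (x : E4) (X Y W : Fin 4 → ℝ) : ℝ :=
  ip G x (fun μ ↦ ∑ α, ∑ β, Gam G x μ α β * X α * Y β) W

/-- `(∂_X g)(V, W)` for the components of the metric. -/
def dip (G : E4 → Matrix (Fin 4) (Fin 4) ℝ) (x : E4) (X V W : Fin 4 → ℝ) : ℝ :=
  ∑ μ, ∑ ν, V μ * dirD X (fun y ↦ G y μ ν) x * W ν

theorem dip_eq (G : E4 → Matrix (Fin 4) (Fin 4) ℝ) (x : E4) (X V W : Fin 4 → ℝ) :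
    dip G x X V W = ∑ μ, ∑ ν, ∑ α, X α * V μ * W ν * pd α (fun y ↦ G y μ ν) x := by
  simp only [dip, dirD, Finset.mul_sum, Finset.sum_mul]
  exact Finset.sum_congr rfl fun μ _ ↦ Finset.sum_congr rfl fun ν _ ↦
    Finset.sum_congr rfl fun α _ ↦ by ring

/-- The Koszul formula for vectors with constant components. It removes the inverse metric, so later
computations only need derivatives of the metric components. -/
theorem ipGam_eq {G : E4 → Matrix (Fin 4) (Fin 4) ℝ} {x : E4} (hs : (G x).IsSymm)
    (hdet : IsUnit (G x).det) (X Y W : Fin 4 → ℝ) :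
    ipGam G x X Y W = 1 / 2 * (dip G x X W Y + dip G x Y W X - dip G x W X Y) := by
  have h : ∀ ν, ∑ μ, G x ν μ * (∑ α, ∑ β, Gam G x μ α β * X α * Y β)
      = ∑ α, ∑ β, X α * Y β * (1 / 2 * (pd α (fun y ↦ G y ν β) x + pd β (fun y ↦ G y ν α) x
        - pd ν (fun y ↦ G y α β) x)) := by
    intro ν
    simp only [Finset.mul_sum]
    rw [Finset.sum_comm]
    refine Finset.sum_congr rfl fun α _ ↦ ?_
    rw [Finset.sum_comm]
    refine Finset.sum_congr rfl fun β _ ↦ ?_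
    rw [← sum_mul_christoffel hdet (fun i a b ↦ pd i (fun y ↦ G y a b) x) ν α β, Finset.mul_sum]
    refine Finset.sum_congr rfl fun μ _ ↦ ?_
    rw [Gam]
    ring
  have h1 : ipGam G x X Y W = ∑ ν, W ν * ∑ μ, G x ν μ * (∑ α, ∑ β, Gam G x μ α β * X α * Y β) := by
    rw [ipGam, ip_comm hs]
    rfl
  rw [h1]
  simp only [h]
  simp only [dip_eq, Finset.mul_sum]
  have e1 : ∑ μ, ∑ ν, ∑ α, X α * W μ * Y ν * pd α (fun y ↦ G y μ ν) x
      = ∑ ν, ∑ α, ∑ β, X α * W ν * Y β * pd α (fun y ↦ G y ν β) x :=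
    Finset.sum_congr rfl fun ν _ ↦ Finset.sum_comm
  have e2 : ∑ μ, ∑ ν, ∑ α, W α * X μ * Y ν * pd α (fun y ↦ G y μ ν) x
      = ∑ ν, ∑ α, ∑ β, W ν * X α * Y β * pd ν (fun y ↦ G y α β) x := by
    rw [Finset.sum_comm' (t' := Finset.univ) (s' := fun _ ↦ Finset.univ) (by simp)]
    rw [Finset.sum_congr rfl fun ν _ ↦ Finset.sum_comm, Finset.sum_comm]
    exact Finset.sum_congr rfl fun ν _ ↦ Finset.sum_comm
  rw [e1, e2]
  simp only [← Finset.sum_add_distrib, ← Finset.sum_sub_distrib, Finset.mul_sum]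
  refine Finset.sum_congr rfl fun ν _ ↦ Finset.sum_congr rfl fun α _ ↦
    Finset.sum_congr rfl fun β _ ↦ ?_
  ring

/-! ### The metric in normal form -/

/-- The components of the metric are differentiable on the open set `U` and are those of a
double null coordinate system. -/
structure IsDoubleNullOn (G : E4 → Matrix (Fin 4) (Fin 4) ℝ) (U : Set E4) : Prop where
  isOpen : IsOpen U
  differentiable : ∀ x ∈ U, ∀ μ ν, DifferentiableAt ℝ (fun y ↦ G y μ ν) x
  pointwise : ∀ x ∈ U, IsDoubleNullAt G x

/-- The angular components of `V - V(s) L̲`. -/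
def angPart (b : Fin 2 → ℝ) (V : Fin 4 → ℝ) (i : Fin 2) : ℝ := V (ang i) - V 0 * b i

/-- The derivative of `2Ω² (ds ⊗ ds̲ + ds̲ ⊗ ds) + g̸ᵢⱼ (dθⁱ - bⁱ ds) ⊗ (dθʲ - bʲ ds)`, evaluated on
`V` and `W`, if the derivatives of `Ω²`, `b` and `g̸` are `o'`, `b'` and `γ'`. -/
def dNormalForm (b : Fin 2 → ℝ) (γ : Fin 2 → Fin 2 → ℝ) (o' : ℝ) (b' : Fin 2 → ℝ)
    (γ' : Fin 2 → Fin 2 → ℝ) (V W : Fin 4 → ℝ) : ℝ :=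
  2 * o' * (V 0 * W 1 + V 1 * W 0) + ∑ i, ∑ j, (γ' i j * angPart b V i * angPart b W j
    - γ i j * (V 0 * b' i * angPart b W j + angPart b V i * (W 0 * b' j)))

theorem IsDoubleNullAt.ip_eq {G : E4 → Matrix (Fin 4) (Fin 4) ℝ} {x : E4} (h : IsDoubleNullAt G x)
    (V W : Fin 4 → ℝ) : ip G x V W = 2 * Om G x ^ 2 * (V 0 * W 1 + V 1 * W 0) +
      ∑ i, ∑ j, slashg G x i j * angPart (b G x) V i * angPart (b G x) W j := by
  rw [ip, h.eq_normalForm, h.slashg_symm 1 0]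
  simp [Matrix.mulVec, dotProduct, Fin.sum_univ_four, Fin.sum_univ_two, angPart, ang]
  rw [h.slashg_symm 1 0]
  ring

namespace IsDoubleNullOn

variable {G : E4 → Matrix (Fin 4) (Fin 4) ℝ} {U : Set E4} {x : E4}

theorem eventually (h : IsDoubleNullOn G U) (hx : x ∈ U) : ∀ᶠ y in nhds x, IsDoubleNullAt G y :=
  Filter.eventually_of_mem (h.isOpen.mem_nhds hx) h.pointwise

theorem differentiableAt_slashg (h : IsDoubleNullOn G U) (hx : x ∈ U) (i j : Fin 2) :
    DifferentiableAt ℝ (fun y ↦ slashg G y i j) x := by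
  simp only [IsDoubleNullAt.slashg_apply]
  exact h.differentiable x hx _ _

/-- `Ω` is defined through the inverse metric, but by the normal form `Ω²` is half of a metric
component throughout a neighbourhood. -/
theorem differentiableAt_om_sq (h : IsDoubleNullOn G U) (hx : x ∈ U) :
    DifferentiableAt ℝ (fun y ↦ Om G y ^ 2) x := by
  have h1 : (fun y ↦ Om G y ^ 2) =ᶠ[nhds x] fun y ↦ 1 / 2 * G y 0 1 := by
    filter_upwards [h.eventually hx] with y hy
    rw [hy.eq_normalForm]
    simp
  exact ((h.differentiable x hx 0 1).const_mul _).congr_of_eventuallyEq h1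

theorem slashg_det_pos (h : IsDoubleNullOn G U) (hx : x ∈ U) :
    0 < slashg G x 0 0 * slashg G x 1 1 - slashg G x 0 1 * slashg G x 1 0 := by
  rw [← Matrix.det_fin_two]
  exact (h.pointwise x hx).slashg_posDef.det_pos

/-- The components `g(∂_s, ∂ᵢ) = -g̸ᵢⱼbʲ` form a linear system for `b`; Cramer's rule writes `b` as
a quotient of metric components with denominator `det g̸ > 0`. -/
theorem differentiableAt_b (h : IsDoubleNullOn G U) (hx : x ∈ U) (k : Fin 2) :
    DifferentiableAt ℝ (fun y ↦ b G y k) x := by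
  have hd := fun i j ↦ h.differentiableAt_slashg hx i j
  have hG := fun μ ν ↦ h.differentiable x hx μ ν
  have hdet : DifferentiableAt ℝ (fun y ↦
      slashg G y 0 0 * slashg G y 1 1 - slashg G y 0 1 * slashg G y 1 0) x := by
    have := hd 0 0; have := hd 0 1; have := hd 1 0; have := hd 1 1
    fun_prop
  have h0 : (fun y ↦ b G y 0) =ᶠ[nhds x] fun y ↦
      (slashg G y 0 1 * G y 0 3 - slashg G y 1 1 * G y 0 2) /
        (slashg G y 0 0 * slashg G y 1 1 - slashg G y 0 1 * slashg G y 1 0) := by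
    filter_upwards [h.isOpen.mem_nhds hx] with y hy
    have hp := h.slashg_det_pos hy
    rw [eq_div_iff hp.ne']
    have e2 : G y 0 2 = -∑ j, slashg G y 0 j * b G y j := by
      conv_lhs => rw [(h.pointwise y hy).eq_normalForm]
      simp
    have e3 : G y 0 3 = -∑ j, slashg G y 1 j * b G y j := by
      conv_lhs => rw [(h.pointwise y hy).eq_normalForm]
      simp
    rw [e2, e3, Fin.sum_univ_two, Fin.sum_univ_two]
    ring
  have h1 : (fun y ↦ b G y 1) =ᶠ[nhds x] fun y ↦
      (slashg G y 1 0 * G y 0 2 - slashg G y 0 0 * G y 0 3) /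
        (slashg G y 0 0 * slashg G y 1 1 - slashg G y 0 1 * slashg G y 1 0) := by
    filter_upwards [h.isOpen.mem_nhds hx] with y hy
    have hp := h.slashg_det_pos hy
    rw [eq_div_iff hp.ne']
    have e2 : G y 0 2 = -∑ j, slashg G y 0 j * b G y j := by
      conv_lhs => rw [(h.pointwise y hy).eq_normalForm]
      simp
    have e3 : G y 0 3 = -∑ j, slashg G y 1 j * b G y j := by
      conv_lhs => rw [(h.pointwise y hy).eq_normalForm]
      simp
    rw [e2, e3, Fin.sum_univ_two, Fin.sum_univ_two]
    ring
  have hp := (h.slashg_det_pos hx).ne'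
  fin_cases k
  · refine h0.differentiableAt_iff.2 ?_
    simp only [div_eq_mul_inv]
    exact (((hd 0 1).fun_mul (hG 0 3)).fun_sub ((hd 1 1).fun_mul (hG 0 2))).fun_mul (hdet.fun_inv hp)
  · refine h1.differentiableAt_iff.2 ?_
    simp only [div_eq_mul_inv]
    exact (((hd 1 0).fun_mul (hG 0 2)).fun_sub ((hd 0 0).fun_mul (hG 0 3))).fun_mul (hdet.fun_inv hp)

/-- The normal form holds on a neighbourhood and may be differentiated with `V`, `W` frozen. The
angular part of `V` then varies only through `b`, with derivative `-V(s)∂b`. -/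
theorem dip_eq_dNormalForm (h : IsDoubleNullOn G U) (hx : x ∈ U) (X V W : Fin 4 → ℝ) :
    dip G x X V W = dNormalForm (b G x) (slashg G x) (dirD X (fun y ↦ Om G y ^ 2) x)
      (fun k ↦ dirD X (fun y ↦ b G y k) x) (fun i j ↦ dirD X (fun y ↦ slashg G y i j) x) V W := by
  have hpd : ∀ α, ∑ μ, ∑ ν, V μ * pd α (fun y ↦ G y μ ν) x * W ν
      = dNormalForm (b G x) (slashg G x) (pd α (fun y ↦ Om G y ^ 2) x)
      (fun k ↦ pd α (fun y ↦ b G y k) x) (fun i j ↦ pd α (fun y ↦ slashg G y i j) x) V W := by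
    intro α
    have hG := fun μ ν ↦ h.differentiable x hx μ ν
    have hγ := fun i j ↦ h.differentiableAt_slashg hx i j
    have hb := fun k ↦ h.differentiableAt_b hx k
    have ho := h.differentiableAt_om_sq hx
    have hV : ∀ (V : Fin 4 → ℝ) k, DifferentiableAt ℝ (fun y ↦ angPart (b G y) V k) x := by
      intro V k
      have := hb k
      unfold angPart
      fun_prop
    have hVpd : ∀ (V : Fin 4 → ℝ) k, pd α (fun y ↦ angPart (b G y) V k) x
        = -(V 0 * pd α (fun y ↦ b G y k) x) := by
      intro V k
      unfold angPart
      rw [pd_sub (by fun_prop) ((hb k).const_mul _), pd_const, pd_const_mul _ (hb k), zero_sub]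
    have e1 : pd α (fun y ↦ ip G y V W) x = ∑ μ, ∑ ν, V μ * pd α (fun y ↦ G y μ ν) x * W ν := by
      simp only [ip_eq_sum]
      rw [pd_sum _ fun μ _ ↦ DifferentiableAt.fun_sum fun ν _ ↦
        ((hG μ ν).const_mul _).mul_const _]
      refine Finset.sum_congr rfl fun μ _ ↦ ?_
      rw [pd_sum _ fun ν _ ↦ ((hG μ ν).const_mul _).mul_const _]
      refine Finset.sum_congr rfl fun ν _ ↦ ?_
      rw [pd_mul ((hG μ ν).const_mul _) (by fun_prop), pd_const, pd_const_mul _ (hG μ ν)]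
      ring
    have e2 : (fun y ↦ ip G y V W) =ᶠ[nhds x] fun y ↦
        Om G y ^ 2 * (2 * (V 0 * W 1 + V 1 * W 0)) +
        ∑ i, ∑ j, slashg G y i j * angPart (b G y) V i * angPart (b G y) W j := by
      filter_upwards [h.eventually hx] with y hy
      rw [hy.ip_eq]
      ring
    rw [← e1, pd_congr e2, pd_add (ho.mul_const _) (DifferentiableAt.fun_sum fun i _ ↦
      DifferentiableAt.fun_sum fun j _ ↦ ((hγ i j).fun_mul (hV V i)).fun_mul (hV W j)),
      pd_mul ho (by fun_prop), pd_const,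
      pd_sum _ fun i _ ↦ DifferentiableAt.fun_sum fun j _ ↦
        ((hγ i j).fun_mul (hV V i)).fun_mul (hV W j)]
    unfold dNormalForm
    congr 1
    · ring
    refine Finset.sum_congr rfl fun i _ ↦ ?_
    rw [pd_sum _ fun j _ ↦ ((hγ i j).fun_mul (hV V i)).fun_mul (hV W j)]
    refine Finset.sum_congr rfl fun j _ ↦ ?_
    rw [pd_mul ((hγ i j).fun_mul (hV V i)) (hV W j), pd_mul (hγ i j) (hV V i), hVpd, hVpd]
    ring
  have h1 : dip G x X V W = ∑ α, X α * ∑ μ, ∑ ν, V μ * pd α (fun y ↦ G y μ ν) x * W ν := by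
    rw [dip_eq]
    simp only [Finset.mul_sum]
    rw [Finset.sum_congr rfl fun μ _ ↦ Finset.sum_comm, Finset.sum_comm]
    refine Finset.sum_congr rfl fun α _ ↦ Finset.sum_congr rfl fun μ _ ↦
      Finset.sum_congr rfl fun ν _ ↦ ?_
    ring
  rw [h1]
  simp only [hpd]
  simp only [dNormalForm, dirD, Fin.sum_univ_four, Fin.sum_univ_two]
  ring

end IsDoubleNullOn

/-! ### Structure coefficients as derivatives of `Ω²`, `b` and `g̸` -/

theorem ip_cov (G : E4 → Matrix (Fin 4) (Fin 4) ℝ) (x : E4) (X : Fin 4 → ℝ) (V : E4 → Fin 4 → ℝ)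
    (W : Fin 4 → ℝ) : ip G x (cov G X V x) W =
      ip G x (fun μ ↦ dirD X (fun y ↦ V y μ) x) W + ipGam G x X (V x) W := by
  rw [ipGam, ← ip_add_left]
  rfl

theorem ip_covAlong (G : E4 → Matrix (Fin 4) (Fin 4) ℝ) (f fbar : E2 → ℝ) (i : Fin 2)
    (V : E2 → Fin 4 → ℝ) (t : E2) (W : Fin 4 → ℝ) :
    ip G (graph f fbar t) (covAlong G f fbar i V t) W =
      ip G (graph f fbar t) (fun μ ↦ pd i (fun r ↦ V r μ) t) W +
      ipGam G (graph f fbar t) (tang f fbar t i) (V t) W := by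
  rw [ipGam, ← ip_add_left]
  rfl

namespace IsDoubleNullOn

variable {G : E4 → Matrix (Fin 4) (Fin 4) ℝ} {U : Set E4} {x : E4}

theorem dirD_L (h : IsDoubleNullOn G U) (hx : x ∈ U) (X : Fin 4 → ℝ) (μ : Fin 4) :
    dirD X (fun y ↦ L G y μ) x = 0 := by
  have h1 : (fun y ↦ L G y μ) =ᶠ[nhds x] fun _ ↦ (![0, 1, 0, 0] : Fin 4 → ℝ) μ := by
    filter_upwards [h.eventually hx] with y hy
    rw [hy.L_eq]
  simp [dirD, pd_congr h1, pd_const]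

theorem dirD_Lbar (h : IsDoubleNullOn G U) (hx : x ∈ U) (X : Fin 4 → ℝ) :
    (fun μ ↦ dirD X (fun y ↦ Lbar G y μ) x) =
      ![0, 0, dirD X (fun y ↦ b G y 0) x, dirD X (fun y ↦ b G y 1) x] := by
  have h1 : ∀ μ, (fun y ↦ Lbar G y μ) =ᶠ[nhds x]
      fun y ↦ (![1, 0, b G y 0, b G y 1] : Fin 4 → ℝ) μ := by
    intro μ
    filter_upwards [h.eventually hx] with y hy
    rw [hy.Lbar_eq]
  have h2 : ∀ μ, dirD X (fun y ↦ Lbar G y μ) x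
      = dirD X (fun y ↦ (![1, 0, b G y 0, b G y 1] : Fin 4 → ℝ) μ) x :=
    fun μ ↦ Finset.sum_congr rfl fun α _ ↦ by rw [pd_congr (h1 μ)]
  ext μ
  rw [h2]
  fin_cases μ <;> simp [dirD, pd_const]

theorem ipGam_eq_dNormalForm (h : IsDoubleNullOn G U) (hx : x ∈ U) (X Y W : Fin 4 → ℝ) :
    ipGam G x X Y W = 1 / 2 *
      (dNormalForm (b G x) (slashg G x) (dirD X (fun y ↦ Om G y ^ 2) x)
        (fun k ↦ dirD X (fun y ↦ b G y k) x) (fun i j ↦ dirD X (fun y ↦ slashg G y i j) x) W Y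
      + dNormalForm (b G x) (slashg G x) (dirD Y (fun y ↦ Om G y ^ 2) x)
        (fun k ↦ dirD Y (fun y ↦ b G y k) x) (fun i j ↦ dirD Y (fun y ↦ slashg G y i j) x) W X
      - dNormalForm (b G x) (slashg G x) (dirD W (fun y ↦ Om G y ^ 2) x)
        (fun k ↦ dirD W (fun y ↦ b G y k) x) (fun i j ↦ dirD W (fun y ↦ slashg G y i j) x) X Y) := by
  rw [ipGam_eq (h.pointwise x hx).symm (h.pointwise x hx).lorentz.isUnit_det]
  simp only [h.dip_eq_dNormalForm hx]

theorem pd_slashg_symm (h : IsDoubleNullOn G U) (hx : x ∈ U) (α : Fin 4) (i j : Fin 2) :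
    pd α (fun y ↦ slashg G y i j) x = pd α (fun y ↦ slashg G y j i) x :=
  pd_congr <| by
    filter_upwards [h.eventually hx] with y hy
    rw [hy.slashg_symm]

/-- `2χᵢⱼ = ∂_s̲ g̸ᵢⱼ`. -/
theorem chi_eq (h : IsDoubleNullOn G U) (hx : x ∈ U) (i j : Fin 2) :
    chi G x i j = 1 / 2 * pd 1 (fun y ↦ slashg G y i j) x := by
  have hs := h.pd_slashg_symm hx 1 1 0
  have e : chi G x i j = ip G x (cov G (coordVec (ang i)) (L G) x) (coordVec (ang j)) := rfl
  rw [e, ip_cov, h.ipGam_eq_dNormalForm hx, (h.pointwise x hx).L_eq]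
  simp only [h.dirD_L hx]
  fin_cases i <;> fin_cases j <;>
    simp [ip, dNormalForm, dirD, angPart, ang, coordVec, Pi.single_apply, Fin.sum_univ_four, hs]

/-- `2χ̲ᵢⱼ` is the derivative of `g̸` along `L̲`. -/
theorem chibar_eq (h : IsDoubleNullOn G U) (hx : x ∈ U) (i j : Fin 2) :
    chibar G x i j = 1 / 2 * (pd 0 (fun y ↦ slashg G y i j) x +
      ∑ k, (b G x k * pd (ang k) (fun y ↦ slashg G y i j) x +
        slashg G x k j * pd (ang i) (fun y ↦ b G y k) x +
        slashg G x i k * pd (ang j) (fun y ↦ b G y k) x)) := by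
  have hs := fun α ↦ h.pd_slashg_symm hx α 1 0
  have hs' := (h.pointwise x hx).slashg_symm 1 0
  have e : chibar G x i j = ip G x (cov G (coordVec (ang i)) (Lbar G) x) (coordVec (ang j)) := rfl
  rw [e, ip_cov, h.ipGam_eq_dNormalForm hx, h.dirD_Lbar hx, (h.pointwise x hx).Lbar_eq,
    (h.pointwise x hx).ip_eq]
  fin_cases i <;> fin_cases j <;>
    simp [dNormalForm, dirD, angPart, ang, coordVec, Pi.single_apply, Fin.sum_univ_four, hs,
      hs'] <;> ring

/-- The factor `2Ω²` replaces `L'` by `L` in the definition and keeps the relation polynomial.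
Compared with `etabar_eq`, only the sign of the `∂_s̲ b` term differs. -/
theorem eta_eq (h : IsDoubleNullOn G U) (hx : x ∈ U) (i : Fin 2) :
    2 * Om G x ^ 2 * eta G x i = pd (ang i) (fun y ↦ Om G y ^ 2) x +
      1 / 2 * ∑ k, slashg G x i k * pd 1 (fun y ↦ b G y k) x := by
  have hs := fun α ↦ h.pd_slashg_symm hx α 1 0
  have hs' := (h.pointwise x hx).slashg_symm 1 0
  have e : 2 * Om G x ^ 2 * eta G x i =
      ip G x (cov G (coordVec (ang i)) (Lbar G) x) (L G x) := by
    rw [L, eta, ip_smul_right]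
    ring
  rw [e, ip_cov, h.ipGam_eq_dNormalForm hx, h.dirD_Lbar hx, (h.pointwise x hx).Lbar_eq,
    (h.pointwise x hx).L_eq, (h.pointwise x hx).ip_eq]
  fin_cases i <;>
    simp [dNormalForm, dirD, angPart, ang, coordVec, Pi.single_apply, Fin.sum_univ_four, hs,
      hs'] <;> ring

theorem etabar_eq (h : IsDoubleNullOn G U) (hx : x ∈ U) (i : Fin 2) :
    2 * Om G x ^ 2 * etabar G x i = pd (ang i) (fun y ↦ Om G y ^ 2) x -
      1 / 2 * ∑ k, slashg G x i k * pd 1 (fun y ↦ b G y k) x := by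
  have hs := fun α ↦ h.pd_slashg_symm hx α 1 0
  have hs' := (h.pointwise x hx).slashg_symm 1 0
  have e : 2 * Om G x ^ 2 * etabar G x i =
      ip G x (cov G (coordVec (ang i)) (L G) x) (Lbar G x) := by
    rw [Lbar, etabar, ip_smul_right]
    ring
  rw [e, ip_cov, h.ipGam_eq_dNormalForm hx, (h.pointwise x hx).Lbar_eq,
    (h.pointwise x hx).L_eq]
  simp only [h.dirD_L hx]
  fin_cases i <;>
    simp [ip, dNormalForm, dirD, angPart, ang, coordVec, Pi.single_apply, Fin.sum_univ_four, hs,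
      hs'] <;> ring

theorem pd_log_om (h : IsDoubleNullOn G U) (hx : x ∈ U) (α : Fin 4) :
    2 * Om G x ^ 2 * pd α (fun y ↦ Real.log (Om G y)) x = pd α (fun y ↦ Om G y ^ 2) x := by
  -- Differentiability is available for `Ω²`, not for `Ω`, so the logarithm is written through the
  -- square.
  have h1 : (fun y ↦ Real.log (Om G y)) = fun y ↦ 1 / 2 * Real.log (Om G y ^ 2) := by
    ext y
    rw [Real.log_pow]
    push_cast
    ring
  have h2 := h.differentiableAt_om_sq hx
  have h3 := (h.pointwise x hx).om_sq_pos.ne'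
  have h4 := (h.pointwise x hx).om_pos.ne'
  rw [h1, pd_const_mul _ (h2.log h3), pd, pd, fderiv.log h2 h3]
  simp only [FunLike.coe_smul, Pi.smul_apply, smul_eq_mul]
  field_simp

theorem omega_eq (h : IsDoubleNullOn G U) (hx : x ∈ U) :
    2 * Om G x ^ 2 * omega G x = pd 1 (fun y ↦ Om G y ^ 2) x := by
  rw [omega, Finset.mul_sum]
  simp_rw [mul_left_comm _ (L G x _), h.pd_log_om hx]
  simp [(h.pointwise x hx).L_eq, Fin.sum_univ_four]

theorem omegabar_eq (h : IsDoubleNullOn G U) (hx : x ∈ U) :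
    2 * Om G x ^ 2 * omegabar G x = pd 0 (fun y ↦ Om G y ^ 2) x +
      ∑ k, b G x k * pd (ang k) (fun y ↦ Om G y ^ 2) x := by
  rw [omegabar, Finset.mul_sum]
  simp_rw [mul_left_comm _ (Lbar G x _), h.pd_log_om hx]
  simp [(h.pointwise x hx).Lbar_eq, Fin.sum_univ_four, Fin.sum_univ_two, ang]
  ring

theorem slashGam_eq (h : IsDoubleNullOn G U) (hx : x ∈ U) (l i j : Fin 2) :
    ∑ k, slashg G x l k * slashGam G x k i j = 1 / 2 * (pd (ang i) (fun y ↦ slashg G y l j) x +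
      pd (ang j) (fun y ↦ slashg G y l i) x - pd (ang l) (fun y ↦ slashg G y i j) x) :=
  sum_mul_christoffel (h.pointwise x hx).slashg_posDef.det_pos.ne'.isUnit
    (fun l a c ↦ pd (ang l) (fun y ↦ slashg G y a c) x) l i j

end IsDoubleNullOn

/-! ### The two polynomial identities -/

section Algebra

variable {o w wb : ℝ} {o' : Fin 4 → ℝ} {b : Fin 2 → ℝ} {b' : Fin 4 → Fin 2 → ℝ}
  {γ : Matrix (Fin 2) (Fin 2) ℝ} {γ' : Fin 4 → Fin 2 → Fin 2 → ℝ}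
  {χ χb : Matrix (Fin 2) (Fin 2) ℝ} {η ηb : Fin 2 → ℝ}

/-- `g(Γ(X, Y), W)` in terms of the derivatives `o'`, `b'`, `γ'` of `Ω²`, `b` and `g̸`. -/
def christoffelForm (o' : Fin 4 → ℝ) (b : Fin 2 → ℝ) (b' : Fin 4 → Fin 2 → ℝ)
    (γ : Matrix (Fin 2) (Fin 2) ℝ) (γ' : Fin 4 → Fin 2 → Fin 2 → ℝ) (X Y W : Fin 4 → ℝ) : ℝ :=
  1 / 2 * (dNormalForm b γ (∑ α, X α * o' α) (fun k ↦ ∑ α, X α * b' α k)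
      (fun i j ↦ ∑ α, X α * γ' α i j) W Y
    + dNormalForm b γ (∑ α, Y α * o' α) (fun k ↦ ∑ α, Y α * b' α k)
      (fun i j ↦ ∑ α, Y α * γ' α i j) W X
    - dNormalForm b γ (∑ α, W α * o' α) (fun k ↦ ∑ α, W α * b' α k)
      (fun i j ↦ ∑ α, W α * γ' α i j) X Y)

/-- The relations between the structure coefficients of a double null foliation and the derivatives
`o'`, `b'`, `γ'` of `Ω²`, `b` and `g̸`. -/
structure StructureRelations (o : ℝ) (o' : Fin 4 → ℝ) (b : Fin 2 → ℝ) (b' : Fin 4 → Fin 2 → ℝ)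
    (γ : Matrix (Fin 2) (Fin 2) ℝ) (γ' : Fin 4 → Fin 2 → Fin 2 → ℝ)
    (χ χb : Matrix (Fin 2) (Fin 2) ℝ) (η ηb : Fin 2 → ℝ) (w wb : ℝ) : Prop where
  symm : ∀ i j, γ i j = γ j i
  symm' : ∀ α i j, γ' α i j = γ' α j i
  chi : ∀ i j, χ i j = 1 / 2 * γ' 1 i j
  chibar : ∀ i j, χb i j = 1 / 2 * (γ' 0 i j +
    ∑ k, (b k * γ' (ang k) i j + γ k j * b' (ang i) k + γ i k * b' (ang j) k))
  eta : ∀ i, 2 * o * η i = o' (ang i) + 1 / 2 * ∑ k, γ i k * b' 1 k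
  etabar : ∀ i, 2 * o * ηb i = o' (ang i) - 1 / 2 * ∑ k, γ i k * b' 1 k
  omega : 2 * o * w = o' 1
  omegabar : 2 * o * wb = o' 0 + ∑ k, b k * o' (ang k)

/-- `g(∇̸ᵢ b, v)` in terms of derivatives of `b` and `g̸`. -/
def nablabForm (b : Fin 2 → ℝ) (b' : Fin 4 → Fin 2 → ℝ)
    (γ : Matrix (Fin 2) (Fin 2) ℝ) (γ' : Fin 4 → Fin 2 → Fin 2 → ℝ) (v : Fin 2 → ℝ)
    (i : Fin 2) : ℝ :=
  ∑ k, ∑ l, γ k l * b' (ang i) k * v l + ∑ l, ∑ m, 1 / 2 * (γ' (ang i) l m + γ' (ang m) l i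
    - γ' (ang l) i m) * b m * v l

/-- This is the connection part of `-g(N, ∇ᵢ∂̇ⱼ)` for `N = pL̲ + qL + vᵏ∂ₖ`. The sum over `l` is
`g̸(Γ̸ᵢⱼ, v)`, kept separate so that it can later be absorbed into the Hessians of `f` and `f̲`. -/
theorem christoffelForm_tangent_tangent
    (h : StructureRelations o o' b b' γ γ' χ χb η ηb w wb) (p q : ℝ) (v f fb : Fin 2 → ℝ)
    (i j : Fin 2) :
    -christoffelForm o' b b' γ γ'
      ![f i, fb i, if i = 0 then 1 else 0, if i = 1 then 1 else 0]
      ![f j, fb j, if j = 0 then 1 else 0, if j = 1 then 1 else 0]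
      ![p, q, p * b 0 + v 0, p * b 1 + v 1] =
    p * χb i j + q * χ i j
      - ∑ l, 1 / 2 * (γ' (ang i) l j + γ' (ang j) l i - γ' (ang l) i j) * v l
      - 2 * sym (χ *ᵥ v + (2 * o * p) • ηb) fb i j
      + 2 * sym (nablabForm b b' γ γ' v - χb *ᵥ v - p • χb *ᵥ b - q • χ *ᵥ b
          - (2 * o * q) • η) f i j
      + 2 * (2 * o * (η ⬝ᵥ v) + b ⬝ᵥ χ *ᵥ v + 2 * o * p * (b ⬝ᵥ ηb)) * sym f fb i j
      - 4 * p * w * o * (fb i * fb j)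
      + (2 * (b ⬝ᵥ χb *ᵥ v) + p * (b ⬝ᵥ χb *ᵥ b) + q * (b ⬝ᵥ χ *ᵥ b)
          + 4 * o * q * (b ⬝ᵥ η) - b ⬝ᵥ nablabForm b b' γ γ' v + b' 0 ⬝ᵥ γ *ᵥ v
          - 4 * o * q * wb) * (f i * f j) := by
  have s1 := h.symm 1 0
  have s2 := fun α ↦ h.symm' α 1 0
  have e0 := h.eta 0
  have e1 := h.eta 1
  have eb0 := h.etabar 0
  have eb1 := h.etabar 1
  have hw := h.omega
  have hwb := h.omegabar
  -- The right side is regrouped so that `η, η̲, w, wb` occur only multiplied by `2o`; the relations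
  -- can then be substituted without dividing by `o`.
  have hc : -christoffelForm o' b b' γ γ'
      ![f i, fb i, if i = 0 then 1 else 0, if i = 1 then 1 else 0]
      ![f j, fb j, if j = 0 then 1 else 0, if j = 1 then 1 else 0]
      ![p, q, p * b 0 + v 0, p * b 1 + v 1] =
    p * χb i j + q * χ i j
      - ∑ l, 1 / 2 * (γ' (ang i) l j + γ' (ang j) l i - γ' (ang l) i j) * v l
      - 2 * sym (χ *ᵥ v + p • ![2 * o * ηb 0, 2 * o * ηb 1]) fb i j
      + 2 * sym (nablabForm b b' γ γ' v - χb *ᵥ v - p • χb *ᵥ b - q • χ *ᵥ b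
          - q • ![2 * o * η 0, 2 * o * η 1]) f i j
      + 2 * (2 * o * η 0 * v 0 + 2 * o * η 1 * v 1 + b ⬝ᵥ χ *ᵥ v
        + p * (b 0 * (2 * o * ηb 0) + b 1 * (2 * o * ηb 1))) * sym f fb i j
      - 2 * p * (2 * o * w) * (fb i * fb j)
      + (2 * (b ⬝ᵥ χb *ᵥ v) + p * (b ⬝ᵥ χb *ᵥ b) + q * (b ⬝ᵥ χ *ᵥ b)
          + 2 * q * (b 0 * (2 * o * η 0) + b 1 * (2 * o * η 1))
          - b ⬝ᵥ nablabForm b b' γ γ' v + b' 0 ⬝ᵥ γ *ᵥ v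
          - 2 * q * (2 * o * wb)) * (f i * f j) := by
    rw [e0, e1, eb0, eb1, hw, hwb]
    fin_cases i <;> fin_cases j <;>
    · simp only [christoffelForm, dNormalForm, angPart, sym, nablabForm, h.chi, h.chibar,
        Matrix.mulVec, dotProduct, Fin.sum_univ_two, Fin.sum_univ_four, ang, Pi.add_apply,
        Pi.sub_apply, Pi.smul_apply, smul_eq_mul]
      simp
      simp only [s1, s2]
      ring
  rw [hc]
  fin_cases i <;> fin_cases j <;>
  · simp [sym, dotProduct, Fin.sum_univ_two]
    ring

/-- The first sum is the `∂̇ᵢ`-derivative of the components `bᵏ` of `L̲` paired with `εv`, which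
belongs to `g(∇ᵢL̲̇, L̇)` besides the connection term. The last sum becomes the Christoffel part of
`∇̸ᵢε̲ᵏ`. -/
theorem christoffelForm_tangent_normal
    (h : StructureRelations o o' b b' γ γ' χ χb η ηb w wb) (ε εb : ℝ) (εv εbv f fb : Fin 2 → ℝ)
    (i : Fin 2) :
    ∑ k, ∑ l, γ k l * (f i * b' 0 k + fb i * b' 1 k + b' (ang i) k) * εv l +
    christoffelForm o' b b' γ γ'
      ![f i, fb i, if i = 0 then 1 else 0, if i = 1 then 1 else 0]
      ![1, εb, b 0 + εbv 0, b 1 + εbv 1] ![ε, 1, ε * b 0 + εv 0, ε * b 1 + εv 1] =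
    2 * o * η i + 2 * o * ε * εb * ηb i - (χ *ᵥ εbv) i + εb * (χ *ᵥ εv) i
        + (χb *ᵥ εv) i - ε * (χb *ᵥ εbv) i
        + f i * (4 * o * wb - 2 * o * (b ⬝ᵥ η) - 2 * o * ε * εb * (b ⬝ᵥ ηb)
            + 2 * o * (εbv ⬝ᵥ η) - 2 * o * εb * (η ⬝ᵥ εv)
            + b ⬝ᵥ χ *ᵥ εbv - εb * (b ⬝ᵥ χ *ᵥ εv) + εbv ⬝ᵥ χb *ᵥ εv - b ⬝ᵥ χb *ᵥ εv
            + ε * (b ⬝ᵥ χb *ᵥ εbv) - εbv ⬝ᵥ nablabForm b b' γ γ' εv)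
        + fb i * (-(2 * o * (ηb ⬝ᵥ εv)) + 2 * o * ε * (ηb ⬝ᵥ εbv)
            + 4 * o * ε * εb * w + χ *ᵥ εv ⬝ᵥ εbv)
        + ∑ l, ∑ m, 1 / 2 * (γ' (ang i) l m + γ' (ang m) l i - γ' (ang l) i m) * εbv m * εv l := by
  have s1 := h.symm 1 0
  have s2 := fun α ↦ h.symm' α 1 0
  have ei := h.eta i
  have ebi := h.etabar i
  have e0 := h.eta 0
  have e1 := h.eta 1
  have eb0 := h.etabar 0
  have eb1 := h.etabar 1
  have hw := h.omega
  have hwb := h.omegabar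
  have hc : ∑ k, ∑ l, γ k l * (f i * b' 0 k + fb i * b' 1 k + b' (ang i) k) * εv l +
    christoffelForm o' b b' γ γ'
      ![f i, fb i, if i = 0 then 1 else 0, if i = 1 then 1 else 0]
      ![1, εb, b 0 + εbv 0, b 1 + εbv 1] ![ε, 1, ε * b 0 + εv 0, ε * b 1 + εv 1] =
    (2 * o * η i) + ε * εb * (2 * o * ηb i) - (χ *ᵥ εbv) i + εb * (χ *ᵥ εv) i
        + (χb *ᵥ εv) i - ε * (χb *ᵥ εbv) i
        + f i * (2 * (2 * o * wb) - (b 0 * (2 * o * η 0) + b 1 * (2 * o * η 1))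
            - ε * εb * (b 0 * (2 * o * ηb 0) + b 1 * (2 * o * ηb 1))
            + (εbv 0 * (2 * o * η 0) + εbv 1 * (2 * o * η 1))
            - εb * (εv 0 * (2 * o * η 0) + εv 1 * (2 * o * η 1))
            + b ⬝ᵥ χ *ᵥ εbv - εb * (b ⬝ᵥ χ *ᵥ εv) + εbv ⬝ᵥ χb *ᵥ εv - b ⬝ᵥ χb *ᵥ εv
            + ε * (b ⬝ᵥ χb *ᵥ εbv) - εbv ⬝ᵥ nablabForm b b' γ γ' εv)
        + fb i * (-(εv 0 * (2 * o * ηb 0) + εv 1 * (2 * o * ηb 1))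
            + ε * (εbv 0 * (2 * o * ηb 0) + εbv 1 * (2 * o * ηb 1))
            + 2 * ε * εb * (2 * o * w) + χ *ᵥ εv ⬝ᵥ εbv)
        + ∑ l, ∑ m, 1 / 2 * (γ' (ang i) l m + γ' (ang m) l i - γ' (ang l) i m) * εbv m * εv l := by
    rw [ei, ebi, e0, e1, eb0, eb1, hw, hwb]
    fin_cases i <;>
    · simp only [christoffelForm, dNormalForm, angPart, nablabForm, h.chi, h.chibar,
        Matrix.mulVec, dotProduct, Fin.sum_univ_two, Fin.sum_univ_four, ang]
      simp
      simp only [s1, s2]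
      ring
  rw [hc]
  simp only [dotProduct, Fin.sum_univ_two]
  ring

end Algebra

/-! ### Elementary inequalities behind the null frame -/

/-- If the rank two perturbation `β + o⁻¹ sym(e ⊗ e')` of a positive definite form is positive
definite, then `2o + β(e, e')` exceeds the product of the lengths of `e` and `e'`. -/
theorem gap_of_posDef {E : Type*} [AddCommGroup E] [Module ℝ E] (β : LinearMap.BilinForm ℝ E)
    (hsymm : ∀ v w, β v w = β w v) (hpos : ∀ v, v ≠ 0 → 0 < β v v) {o : ℝ} (ho : 0 < o) (e e' : E)
    (h : ∀ y, y ≠ 0 → 0 < o * β y y + β e y * β e' y) :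
    0 < 2 * o + β e e' ∧ β e e * β e' e' < (2 * o + β e e') ^ 2 := by
  have hnn : ∀ v, 0 ≤ β v v := fun v ↦ by
    rcases eq_or_ne v 0 with rfl | hv
    · simp
    · exact (hpos v hv).le
  set r := √(β e e) with hr
  set r' := √(β e' e') with hr'
  have hr2 : r ^ 2 = β e e := Real.sq_sqrt (hnn e)
  have hr2' : r' ^ 2 = β e' e' := Real.sq_sqrt (hnn e')
  have hr0 : 0 ≤ r := Real.sqrt_nonneg _
  have hr0' : 0 ≤ r' := Real.sqrt_nonneg _
  suffices hgap : r * r' < 2 * o + β e e' by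
    have hp := mul_nonneg hr0 hr0'
    refine ⟨hp.trans_lt hgap, ?_⟩
    rw [← hr2, ← hr2', ← mul_pow]
    exact pow_lt_pow_left₀ hgap hp two_ne_zero
  -- Testing on this vector gives `r r' s (2o - s) > 0`, where `s = r r' - β(e, e')`. Since `r r' ≥
  -- 0`, the value `s ≥ 2o` is excluded, which is the desired gap.
  set y := r' • e - r • e' with hy
  set s := r * r' - β e e' with hs
  have h1 : β y y = 2 * (r * r') * s := by
    simp only [hy, map_sub, map_smul, LinearMap.sub_apply, LinearMap.smul_apply, smul_eq_mul,
      hsymm e' e, ← hr2, ← hr2', hs]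
    ring
  have h2 : β e y = r * s := by
    simp only [hy, map_sub, map_smul, smul_eq_mul, ← hr2, hs]
    ring
  have h3 : β e' y = -(r' * s) := by
    simp only [hy, map_sub, map_smul, smul_eq_mul, ← hr2', hsymm e' e, hs]
    ring
  by_contra! hcon
  have hs2 : 2 * o ≤ s := by linarith
  -- The test is void if `y = 0`; then `r r' s = 0` and `s > 0` force `e = 0` or `e' = 0`, so `s =
  -- 0`, a contradiction.
  rcases eq_or_ne y 0 with h0 | h0
  · rw [h0, map_zero] at h1
    have hp : r * r' = 0 := by
      have h4 : 2 * (r * r') * s = 0 := by simpa using h1.symm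
      have : s ≠ 0 := by linarith
      simpa [this] using h4
    have hzero : β e e' = 0 := by
      rcases mul_eq_zero.1 hp with hq | hq
      · have : e = 0 := by
          by_contra hne
          have := hpos e hne
          rw [← hr2, hq] at this
          simp at this
        simp [this]
      · have : e' = 0 := by
          by_contra hne
          have := hpos e' hne
          rw [← hr2', hq] at this
          simp at this
        simp [this]
    rw [hs, hp, hzero] at hs2
    linarith
  · have h4 := h y h0
    rw [h1, h2, h3] at h4
    have h5 : 0 ≤ r * r' * s * (s - 2 * o) :=
      mul_nonneg (mul_nonneg (mul_nonneg hr0 hr0') (by linarith)) (by linarith)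
    nlinarith

/-- `D` is a root of `D² - 2XD + ac = 0`, and dividing this by `D²` gives both quadratics. With `a =
|e|²`, `c = |e̲|²` they are the null conditions for `L̇` and `L̲̇`; the last quantity is `g(L̲̇,
L̇)` and equals `2(X² - ac)/D`. -/
theorem eps_identities {X a c : ℝ} (hX : 0 < X) (hP : a * c < X ^ 2) :
    let D := X + √(X ^ 2 - a * c)
    0 < D ∧ a + 2 * (-a / D) * X + (-a / D) ^ 2 * c = 0 ∧
      c + 2 * (-c / D) * X + (-c / D) ^ 2 * a = 0 ∧
      0 < X * (1 + (-a / D) * (-c / D)) + (-c / D) * a + (-a / D) * c := by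
  intro D
  have hS : 0 < √(X ^ 2 - a * c) := Real.sqrt_pos.2 (by linarith)
  have hD : 0 < D := by positivity
  have hD2 : D ^ 2 - 2 * X * D + a * c = 0 := by
    have := Real.sq_sqrt (sub_pos.2 hP).le
    simp only [D]
    linear_combination this
  refine ⟨hD, ?_, ?_, ?_⟩
  · field_simp
    linear_combination a * hD2
  · field_simp
    linear_combination c * hD2
  · have h1 : X * (1 + (-a / D) * (-c / D)) + (-c / D) * a + (-a / D) * c
        = 2 * (X ^ 2 - a * c) / D := by
      field_simp
      linear_combination X * hD2
    rw [h1]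
    exact div_pos (by linarith) hD

/-- The vector `p L̲ + q L + vⁱ ∂ᵢ`. -/
def frameVec (b : Fin 2 → ℝ) (p q : ℝ) (v : Fin 2 → ℝ) : Fin 4 → ℝ :=
  ![p, q, p * b 0 + v 0, p * b 1 + v 1]

theorem angPart_frameVec (b : Fin 2 → ℝ) (p q : ℝ) (v : Fin 2 → ℝ) :
    angPart b (frameVec b p q v) = v := by
  ext i
  fin_cases i <;> simp [angPart, frameVec, ang]

theorem IsDoubleNullAt.ip_frameVec {G : E4 → Matrix (Fin 4) (Fin 4) ℝ} {x : E4}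
    (h : IsDoubleNullAt G x) (p q : ℝ) (v : Fin 2 → ℝ) (W : Fin 4 → ℝ) :
    ip G x (frameVec (b G x) p q v) W = 2 * Om G x ^ 2 * (p * W 1 + q * W 0) +
      v ⬝ᵥ (slashg G x *ᵥ angPart (b G x) W) := by
  rw [h.ip_eq, angPart_frameVec]
  simp only [dotProduct, Matrix.mulVec, Fin.sum_univ_two]
  simp [frameVec]
  ring

theorem tang_eq (f fbar : E2 → ℝ) (t : E2) (i : Fin 2) : tang f fbar t i =
    ![pd i f t, pd i fbar t, if i = 0 then 1 else 0, if i = 1 then 1 else 0] := by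
  ext μ
  fin_cases μ
  · rfl
  · rfl
  · exact pd_coord i 0 t
  · exact pd_coord i 1 t

/-! ### The null normal frame of the surface -/

section Graph

variable {G : E4 → Matrix (Fin 4) (Fin 4) ℝ} {U : Set E4} {V : Set E2} {f fbar : E2 → ℝ} {t : E2}

theorem angPart_tang (i : Fin 2) :
    angPart (b G (graph f fbar t)) (tang f fbar t i) = B G f fbar t i := by
  ext j
  rw [tang_eq]
  fin_cases i <;> fin_cases j <;> simp [angPart, ang, B]

theorem dotL_eq (h : IsDoubleNullAt G (graph f fbar t)) :
    dotL G f fbar t = frameVec (b G (graph f fbar t)) (eps G f fbar t) 1 (epsVec G f fbar t) := by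
  rw [dotL, h.L_eq, h.Lbar_eq]
  ext μ
  fin_cases μ <;> simp [frameVec, coordVec, ang]

theorem dotLbar_eq (h : IsDoubleNullAt G (graph f fbar t)) :
    dotLbar G f fbar t =
      frameVec (b G (graph f fbar t)) 1 (epsbar G f fbar t) (epsbarVec G f fbar t) := by
  rw [dotLbar, h.L_eq, h.Lbar_eq]
  ext μ
  fin_cases μ <;> simp [frameVec, coordVec, ang]

theorem slashg_mulVec_eAux (hx : IsDoubleNullAt G (graph f fbar t)) (h : E2 → ℝ) :
    slashg G (graph f fbar t) *ᵥ eAux G f fbar h t =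
      (-2 * Om G (graph f fbar t) ^ 2) • ((B G f fbar t)⁻¹ *ᵥ fun i ↦ pd i h t) := by
  set γ := slashg G (graph f fbar t) with hγ
  have hs : γᵀ = γ := by
    ext i j
    exact hx.slashg_symm j i
  have hu : IsUnit γ.det := hx.slashg_posDef.det_pos.ne'.isUnit
  have hsi : ∀ i j, γ⁻¹ i j = γ⁻¹ j i := fun i j ↦ by
    conv_lhs => rw [← hs, ← Matrix.transpose_nonsing_inv]
    rfl
  have h1 : eAux G f fbar h t = (-2 * Om G (graph f fbar t) ^ 2) •
      (γ⁻¹ *ᵥ ((B G f fbar t)⁻¹ *ᵥ fun i ↦ pd i h t)) := by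
    ext k
    simp only [eAux, Matrix.mulVec, dotProduct, Pi.smul_apply, smul_eq_mul, Fin.sum_univ_two,
      ← hγ, hsi k]
    ring
  rw [h1, Matrix.mulVec_smul, Matrix.mulVec_mulVec, Matrix.mul_nonsing_inv _ hu, Matrix.one_mulVec]

/-- The defining property of `e`: the angular part of `∂̇ᵢ` is the row `Bᵢ`, and `g(L, ∂̇ᵢ) =
2Ω²fᵢ`, so this equation makes `L + eᵏ∂ₖ` normal for `h = f`, and `L̲ + e̲ᵏ∂ₖ` for `h = f̲`. -/
theorem B_mulVec_slashg_mulVec_eAux (hx : IsDoubleNullAt G (graph f fbar t))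
    (hB : IsUnit (B G f fbar t)) (h : E2 → ℝ) (i : Fin 2) :
    B G f fbar t i ⬝ᵥ (slashg G (graph f fbar t) *ᵥ eAux G f fbar h t) =
      -2 * Om G (graph f fbar t) ^ 2 * pd i h t := by
  have h1 : B G f fbar t *ᵥ (slashg G (graph f fbar t) *ᵥ eAux G f fbar h t) =
      (-2 * Om G (graph f fbar t) ^ 2) • fun i ↦ pd i h t := by
    rw [slashg_mulVec_eAux hx, Matrix.mulVec_smul, Matrix.mulVec_mulVec,
      Matrix.mul_nonsing_inv _ ((Matrix.isUnit_iff_isUnit_det _).1 hB), Matrix.one_mulVec]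
  exact congrFun h1 i

theorem sdot_comm (hx : IsDoubleNullAt G (graph f fbar t)) (v w : Fin 2 → ℝ) :
    sdot G f fbar t v w = sdot G f fbar t w v := by
  simp only [sdot, dotProduct, Matrix.mulVec, Fin.sum_univ_two, hx.slashg_symm 1 0]
  ring

theorem dotProduct_dotg (hx : IsDoubleNullAt G (graph f fbar t)) (u : Fin 2 → ℝ) :
    u ⬝ᵥ dotg G f fbar t *ᵥ u = 4 * Om G (graph f fbar t) ^ 2 * (u ⬝ᵥ fun i ↦ pd i f t) *
      (u ⬝ᵥ fun i ↦ pd i fbar t) + sdot G f fbar t (u ᵥ* B G f fbar t) (u ᵥ* B G f fbar t) := by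
  have h1 : ∀ i j, dotg G f fbar t i j = 2 * Om G (graph f fbar t) ^ 2 *
      (pd i f t * pd j fbar t + pd i fbar t * pd j f t) + ∑ k, ∑ l,
      slashg G (graph f fbar t) k l * B G f fbar t i k * B G f fbar t j l := by
    intro i j
    have : dotg G f fbar t i j = ip G (graph f fbar t) (tang f fbar t i) (tang f fbar t j) := rfl
    rw [this, hx.ip_eq, angPart_tang, angPart_tang]
    simp [tang_eq]
  simp only [sdot, dotProduct, Matrix.mulVec, Matrix.vecMul, Fin.sum_univ_two, h1]
  ring

/-- With `y = uB` one has `e·y = -2Ω² u·df` and `e̲·y = -2Ω² u·df̲`. The induced metric on `u` is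
therefore `|y|² + Ω⁻²(e·y)(e̲·y)`, and its positivity is the hypothesis of `gap_of_posDef`. -/
theorem eAux_gap (hx : IsDoubleNullAt G (graph f fbar t)) (hpos : (dotg G f fbar t).PosDef)
    (hB : IsUnit (B G f fbar t)) :
    let e := eAux G f fbar f t
    let ebar := eAux G f fbar fbar t
    0 < 2 * Om G (graph f fbar t) ^ 2 + sdot G f fbar t e ebar ∧
      sdot G f fbar t e e * sdot G f fbar t ebar ebar <
        (2 * Om G (graph f fbar t) ^ 2 + sdot G f fbar t e ebar) ^ 2 := by
  intro e ebar
  have hβ : ∀ v w, Matrix.toBilin' (slashg G (graph f fbar t)) v w = sdot G f fbar t v w :=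
    fun v w ↦ Matrix.toBilin'_apply' _ _ _
  have hBu := (Matrix.isUnit_iff_isUnit_det _).1 hB
  have key := gap_of_posDef (Matrix.toBilin' (slashg G (graph f fbar t)))
    (fun v w ↦ by rw [hβ, hβ, sdot_comm hx])
    (fun v hv ↦ by
      have hv' := hx.slashg_posDef.dotProduct_mulVec_pos hv
      rw [hβ]
      rwa [star_trivial] at hv') hx.om_sq_pos e ebar (fun y hy ↦ by
      simp only [hβ]
      set u := y ᵥ* (B G f fbar t)⁻¹ with hu
      have huB : u ᵥ* B G f fbar t = y := by
        rw [hu, Matrix.vecMul_vecMul, Matrix.nonsing_inv_mul _ hBu, Matrix.vecMul_one]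
      have hu0 : u ≠ 0 := by
        rintro h0
        rw [h0, Matrix.zero_vecMul] at huB
        exact hy huB.symm
      have hq := hpos.dotProduct_mulVec_pos hu0
      rw [star_trivial, dotProduct_dotg hx, huB] at hq
      have he : ∀ h : E2 → ℝ, sdot G f fbar t (eAux G f fbar h t) y =
          -2 * Om G (graph f fbar t) ^ 2 * (u ⬝ᵥ fun i ↦ pd i h t) := by
        intro h
        rw [sdot_comm hx, sdot, slashg_mulVec_eAux hx, dotProduct_smul, smul_eq_mul, hu,
          Matrix.dotProduct_mulVec]
      rw [he, he]
      have := mul_pos hx.om_sq_pos hq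
      linarith)
  simpa only [hβ] using key

/-- The frame `{L̲̇, L̇}` is a null normal frame. -/
theorem null_frame (hx : IsDoubleNullAt G (graph f fbar t)) (hpos : (dotg G f fbar t).PosDef)
    (hB : IsUnit (B G f fbar t)) :
    ip G (graph f fbar t) (dotLbar G f fbar t) (dotLbar G f fbar t) = 0 ∧
    ip G (graph f fbar t) (dotL G f fbar t) (dotL G f fbar t) = 0 ∧
    (∀ i, ip G (graph f fbar t) (dotLbar G f fbar t) (tang f fbar t i) = 0) ∧
    (∀ i, ip G (graph f fbar t) (dotL G f fbar t) (tang f fbar t i) = 0) ∧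
    ip G (graph f fbar t) (dotLbar G f fbar t) (dotL G f fbar t) =
      2 * Om G (graph f fbar t) ^ 2 * (1 + eps G f fbar t * epsbar G f fbar t) +
        sdot G f fbar t (epsVec G f fbar t) (epsbarVec G f fbar t) ∧
    0 < 2 * Om G (graph f fbar t) ^ 2 * (1 + eps G f fbar t * epsbar G f fbar t) +
        sdot G f fbar t (epsVec G f fbar t) (epsbarVec G f fbar t) := by
  obtain ⟨hX, hP⟩ := eAux_gap hx hpos hB
  obtain ⟨-, h1, h2, h3⟩ := eps_identities hX hP
  set e := eAux G f fbar f t with he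
  set ebar := eAux G f fbar fbar t with hebar
  set o := Om G (graph f fbar t) ^ 2 with ho
  have hε : -sdot G f fbar t e e / (2 * o + sdot G f fbar t e ebar +
      √((2 * o + sdot G f fbar t e ebar) ^ 2 - sdot G f fbar t e e * sdot G f fbar t ebar ebar)) =
      eps G f fbar t := rfl
  have hεb : -sdot G f fbar t ebar ebar / (2 * o + sdot G f fbar t e ebar +
      √((2 * o + sdot G f fbar t e ebar) ^ 2 - sdot G f fbar t e e * sdot G f fbar t ebar ebar)) =
      epsbar G f fbar t := rfl
  rw [hε] at h1 h3
  rw [hεb] at h2 h3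
  have hL := dotL_eq hx
  have hLb := dotLbar_eq hx
  have hv : epsVec G f fbar t = e + eps G f fbar t • ebar := rfl
  have hvb : epsbarVec G f fbar t = ebar + epsbar G f fbar t • e := rfl
  have hadd : ∀ u v w, sdot G f fbar t (u + v) w = sdot G f fbar t u w + sdot G f fbar t v w :=
    fun u v w ↦ add_dotProduct _ _ _
  have hsmul : ∀ (c : ℝ) v w, sdot G f fbar t (c • v) w = c * sdot G f fbar t v w :=
    fun u v w ↦ smul_dotProduct _ _ _
  have hadd' : ∀ u v w, sdot G f fbar t w (u + v) = sdot G f fbar t w u + sdot G f fbar t w v :=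
    fun u v w ↦ by rw [sdot_comm hx, hadd, sdot_comm hx, sdot_comm hx v]
  have hsmul' : ∀ (c : ℝ) v w, sdot G f fbar t w (c • v) = c * sdot G f fbar t w v :=
    fun c v w ↦ by rw [sdot_comm hx, hsmul, sdot_comm hx]
  have hsw := sdot_comm hx ebar e
  have hip : ∀ (p q : ℝ) (v : Fin 2 → ℝ) (p' q' : ℝ) (v' : Fin 2 → ℝ),
      ip G (graph f fbar t) (frameVec (b G (graph f fbar t)) p q v)
        (frameVec (b G (graph f fbar t)) p' q' v') =
      2 * o * (p * q' + q * p') + sdot G f fbar t v v' := by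
    intro p q v p' q' v'
    rw [hx.ip_frameVec, angPart_frameVec]
    rfl
  have hipt : ∀ (p q : ℝ) (v : Fin 2 → ℝ) i, ip G (graph f fbar t)
      (frameVec (b G (graph f fbar t)) p q v) (tang f fbar t i) =
      2 * o * (p * pd i fbar t + q * pd i f t) + sdot G f fbar t v (B G f fbar t i) := by
    intro p q v i
    rw [hx.ip_frameVec, angPart_tang]
    rfl
  have hBe : ∀ h i, sdot G f fbar t (eAux G f fbar h t) (B G f fbar t i) = -2 * o * pd i h t := by
    intro h i
    rw [sdot_comm hx]
    exact B_mulVec_slashg_mulVec_eAux hx hB h i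
  refine ⟨?_, ?_, fun i ↦ ?_, fun i ↦ ?_, ?_, ?_⟩
  · rw [hLb, hip, hvb]
    simp only [hadd, hadd', hsmul, hsmul', hsw]
    linear_combination h2
  · rw [hL, hip, hv]
    simp only [hadd, hadd', hsmul, hsmul', hsw]
    linear_combination h1
  · rw [hLb, hipt, hvb, hadd, hsmul, hBe, hBe]
    ring
  · rw [hL, hipt, hv, hadd, hsmul, hBe, hBe]
    ring
  · rw [hL, hLb, hip, sdot_comm hx]
    ring
  · rw [hv, hvb]
    simp only [hadd, hadd', hsmul, hsmul', hsw]
    linarith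

end Graph

/-! ### Differentiability of the frame along the surface -/

theorem differentiableAt_inv_apply {E : Type*} [NormedAddCommGroup E] [NormedSpace ℝ E]
    {A : E → Matrix (Fin 2) (Fin 2) ℝ} {x : E}
    (hA : ∀ i j, DifferentiableAt ℝ (fun y ↦ A y i j) x) (hx : (A x).det ≠ 0) (i j : Fin 2) :
    DifferentiableAt ℝ (fun y ↦ (A y)⁻¹ i j) x := by
  have h00 := hA 0 0
  have h01 := hA 0 1
  have h10 := hA 1 0
  have h11 := hA 1 1
  have hd : DifferentiableAt ℝ (fun y ↦ (A y).det) x := by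
    simp only [Matrix.det_fin_two]
    fun_prop
  have hi := hd.fun_inv hx
  simp only [Matrix.inv_def, Ring.inverse_eq_inv', Matrix.adjugate_fin_two, Matrix.smul_apply,
    smul_eq_mul]
  refine hi.fun_mul ?_
  fin_cases i <;> fin_cases j <;> simp <;> fun_prop

theorem differentiableAt_pd {n : ℕ} {h : EuclideanSpace ℝ (Fin n) → ℝ}
    {V : Set (EuclideanSpace ℝ (Fin n))} (hV : IsOpen V) (hh : ContDiffOn ℝ ∞ h V)
    {t : EuclideanSpace ℝ (Fin n)} (ht : t ∈ V) (i : Fin n) : DifferentiableAt ℝ (pd i h) t := by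
  have h1 : ContDiffAt ℝ ∞ h t := hh.contDiffAt (hV.mem_nhds ht)
  have h2 : ContDiffAt ℝ 1 (fderiv ℝ h) t := h1.fderiv_right (by norm_cast)
  exact (h2.differentiableAt (by simp)).clm_apply (differentiableAt_const _)

namespace IsSpacelikeGraph

variable {G : E4 → Matrix (Fin 4) (Fin 4) ℝ} {U : Set E4} {V : Set E2} {f fbar : E2 → ℝ} {t : E2}

theorem differentiableAt (hS : IsSpacelikeGraph G U V f fbar) (ht : t ∈ V) :
    DifferentiableAt ℝ f t :=
  (hS.smooth.contDiffAt (hS.isOpen.mem_nhds ht)).differentiableAt (by simp)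

theorem differentiableAt_bar (hS : IsSpacelikeGraph G U V f fbar) (ht : t ∈ V) :
    DifferentiableAt ℝ fbar t :=
  (hS.smooth_bar.contDiffAt (hS.isOpen.mem_nhds ht)).differentiableAt (by simp)

theorem differentiableAt_graph_apply (hS : IsSpacelikeGraph G U V f fbar) (ht : t ∈ V)
    (μ : Fin 4) : DifferentiableAt ℝ (fun r ↦ graph f fbar r μ) t := by
  have hc : ∀ i : Fin 2, DifferentiableAt ℝ (fun r : E2 ↦ r i) t := fun i ↦
    (EuclideanSpace.proj i : E2 →L[ℝ] ℝ).differentiableAt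
  fin_cases μ
  exacts [hS.differentiableAt ht, hS.differentiableAt_bar ht, hc 0, hc 1]

theorem differentiableAt_graph (hS : IsSpacelikeGraph G U V f fbar) (ht : t ∈ V) :
    DifferentiableAt ℝ (graph f fbar) t :=
  differentiableAt_euclidean.2 (hS.differentiableAt_graph_apply ht)

theorem differentiableAt_comp (hS : IsSpacelikeGraph G U V f fbar) (ht : t ∈ V) {F : E4 → ℝ}
    (hF : DifferentiableAt ℝ F (graph f fbar t)) :
    DifferentiableAt ℝ (fun r ↦ F (graph f fbar r)) t :=
  hF.fun_comp' t (hS.differentiableAt_graph ht)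

/-- The chain rule for the restriction of a function to the surface. -/
theorem pd_comp (hS : IsSpacelikeGraph G U V f fbar) (ht : t ∈ V) {F : E4 → ℝ}
    (hF : DifferentiableAt ℝ F (graph f fbar t)) (i : Fin 2) :
    pd i (fun r ↦ F (graph f fbar r)) t = dirD (tang f fbar t i) F (graph f fbar t) := by
  have hg := hS.differentiableAt_graph ht
  have h1 : fderiv ℝ (fun r ↦ F (graph f fbar r)) t =
      (fderiv ℝ F (graph f fbar t)).comp (fderiv ℝ (graph f fbar) t) := fderiv_comp t hF hg
  have h2 : (fun α ↦ fderiv ℝ (graph f fbar) t (EuclideanSpace.single i 1) α) =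
      tang f fbar t i := by
    ext α
    have h3 := ((EuclideanSpace.proj α : E4 →L[ℝ] ℝ).hasFDerivAt.comp t hg.hasFDerivAt).fderiv
    have h4 : tang f fbar t i α = fderiv ℝ ((EuclideanSpace.proj α : E4 →L[ℝ] ℝ) ∘ graph f fbar) t
      (EuclideanSpace.single i 1) := rfl
    rw [h4, h3]
    rfl
  rw [pd, h1, ContinuousLinearMap.comp_apply, fderiv_eq_dirD, h2]

variable (h : IsDoubleNullOn G U) (hS : IsSpacelikeGraph G U V f fbar) (ht : t ∈ V)
include h hS ht

theorem isDoubleNullAt : IsDoubleNullAt G (graph f fbar t) := h.pointwise _ (hS.mem t ht)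

theorem differentiableAt_B (i j : Fin 2) : DifferentiableAt ℝ (fun r ↦ B G f fbar r i j) t := by
  have h1 := differentiableAt_pd hS.isOpen hS.smooth ht i
  have h2 := hS.differentiableAt_comp ht (h.differentiableAt_b (hS.mem t ht) j)
  simp only [B, Matrix.of_apply]
  exact (differentiableAt_const _).fun_sub (h1.fun_mul h2)

/-- Orthogonality of the frame is going to be differentiated, so it must hold near `t` and not only
at `t`. -/
theorem eventually_isUnit_B (hB : IsUnit (B G f fbar t)) :
    ∀ᶠ r in nhds t, r ∈ V ∧ IsUnit (B G f fbar r) := by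
  have h00 := differentiableAt_B h hS ht 0 0
  have h01 := differentiableAt_B h hS ht 0 1
  have h10 := differentiableAt_B h hS ht 1 0
  have h11 := differentiableAt_B h hS ht 1 1
  have hd : ContinuousAt (fun r ↦ (B G f fbar r).det) t := by
    simp only [Matrix.det_fin_two]
    exact ((h00.fun_mul h11).fun_sub (h01.fun_mul h10)).continuousAt
  have h0 : (B G f fbar t).det ≠ 0 := ((Matrix.isUnit_iff_isUnit_det _).1 hB).ne_zero
  filter_upwards [hS.isOpen.mem_nhds ht, hd.eventually_ne h0] with r hr hr'
  exact ⟨hr, (Matrix.isUnit_iff_isUnit_det _).2 hr'.isUnit⟩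

variable (hB : IsUnit (B G f fbar t))
include hB

theorem differentiableAt_eAux {k : E2 → ℝ} (hk : ∀ i, DifferentiableAt ℝ (pd i k) t) (l : Fin 2) :
    DifferentiableAt ℝ (fun r ↦ eAux G f fbar k r l) t := by
  have ho := hS.differentiableAt_comp ht (h.differentiableAt_om_sq (hS.mem t ht))
  have hγ := fun i j ↦ hS.differentiableAt_comp ht (h.differentiableAt_slashg (hS.mem t ht) i j)
  have hBi := differentiableAt_inv_apply (differentiableAt_B h hS ht)
    ((Matrix.isUnit_iff_isUnit_det _).1 hB).ne_zero
  have hγi := differentiableAt_inv_apply hγ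
    (isDoubleNullAt h hS ht).slashg_posDef.det_pos.ne'
  unfold eAux
  exact (ho.const_mul _).fun_mul (DifferentiableAt.fun_sum fun i _ ↦ DifferentiableAt.fun_sum
    fun j _ ↦ ((hk i).fun_mul (hBi j i)).fun_mul (hγi j l))

theorem differentiableAt_e (l : Fin 2) : DifferentiableAt ℝ (fun r ↦ eAux G f fbar f r l) t :=
  differentiableAt_eAux h hS ht hB (differentiableAt_pd hS.isOpen hS.smooth ht) l

theorem differentiableAt_ebar (l : Fin 2) : DifferentiableAt ℝ (fun r ↦ eAux G f fbar fbar r l) t :=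
  differentiableAt_eAux h hS ht hB (differentiableAt_pd hS.isOpen hS.smooth_bar ht) l

omit hB in
theorem differentiableAt_sdot {v w : E2 → Fin 2 → ℝ} (hv : ∀ i, DifferentiableAt ℝ (fun r ↦ v r i) t)
    (hw : ∀ i, DifferentiableAt ℝ (fun r ↦ w r i) t) :
    DifferentiableAt ℝ (fun r ↦ sdot G f fbar r (v r) (w r)) t := by
  have hγ := fun i j ↦ hS.differentiableAt_comp ht (h.differentiableAt_slashg (hS.mem t ht) i j)
  unfold sdot dotProduct Matrix.mulVec dotProduct
  exact DifferentiableAt.fun_sum fun i _ ↦ (hv i).fun_mul (DifferentiableAt.fun_sum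
    fun j _ ↦ (hγ i j).fun_mul (hw j))

theorem epsDen_pos : 0 < epsDen G f fbar t :=
  have hg := eAux_gap (isDoubleNullAt h hS ht) (hS.spacelike t ht) hB
  (eps_identities hg.1 hg.2).1

theorem differentiableAt_epsDen : DifferentiableAt ℝ (fun r ↦ epsDen G f fbar r) t := by
  have he := differentiableAt_e h hS ht hB
  have heb := differentiableAt_ebar h hS ht hB
  have ho := hS.differentiableAt_comp ht (h.differentiableAt_om_sq (hS.mem t ht))
  have hX := (ho.const_mul 2).fun_add (differentiableAt_sdot h hS ht he heb)
  have hP := (differentiableAt_sdot h hS ht he he).fun_mul (differentiableAt_sdot h hS ht heb heb)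
  have hg := eAux_gap (isDoubleNullAt h hS ht) (hS.spacelike t ht) hB
  -- The strict gap keeps the radicand away from zero, where the square root is not differentiable.
  exact hX.fun_add (((hX.fun_pow 2).fun_sub hP).sqrt (sub_pos.2 hg.2).ne')

theorem differentiableAt_eps : DifferentiableAt ℝ (fun r ↦ eps G f fbar r) t := by
  have he := differentiableAt_e h hS ht hB
  unfold eps
  simp only [div_eq_mul_inv]
  exact (differentiableAt_sdot h hS ht he he).fun_neg.fun_mul
    ((differentiableAt_epsDen h hS ht hB).fun_inv (epsDen_pos h hS ht hB).ne')

theorem differentiableAt_epsbar : DifferentiableAt ℝ (fun r ↦ epsbar G f fbar r) t := by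
  have he := differentiableAt_ebar h hS ht hB
  unfold epsbar
  simp only [div_eq_mul_inv]
  exact (differentiableAt_sdot h hS ht he he).fun_neg.fun_mul
    ((differentiableAt_epsDen h hS ht hB).fun_inv (epsDen_pos h hS ht hB).ne')

theorem differentiableAt_epsVec (k : Fin 2) :
    DifferentiableAt ℝ (fun r ↦ epsVec G f fbar r k) t :=
  (differentiableAt_e h hS ht hB k).fun_add
    ((differentiableAt_eps h hS ht hB).fun_mul (differentiableAt_ebar h hS ht hB k))

theorem differentiableAt_epsbarVec (k : Fin 2) :
    DifferentiableAt ℝ (fun r ↦ epsbarVec G f fbar r k) t :=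
  (differentiableAt_ebar h hS ht hB k).fun_add
    ((differentiableAt_epsbar h hS ht hB).fun_mul (differentiableAt_e h hS ht hB k))

end IsSpacelikeGraph

/-! ### The algebraic relations evaluated on the geometric quantities -/

namespace IsDoubleNullOn

variable {G : E4 → Matrix (Fin 4) (Fin 4) ℝ} {U : Set E4} {x : E4}

theorem dip_comm (h : IsDoubleNullOn G U) (hx : x ∈ U) (X V W : Fin 4 → ℝ) :
    dip G x X V W = dip G x X W V := by
  have hs : ∀ μ ν α, pd α (fun y ↦ G y μ ν) x = pd α (fun y ↦ G y ν μ) x := fun μ ν α ↦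
    pd_congr <| by
      filter_upwards [h.eventually hx] with y hy
      exact hy.symm.apply ν μ
  rw [dip, dip, Finset.sum_comm]
  refine Finset.sum_congr rfl fun ν _ ↦ Finset.sum_congr rfl fun μ _ ↦ ?_
  simp only [dirD, hs μ ν]
  ring

theorem structureRelations (h : IsDoubleNullOn G U) (hx : x ∈ U) :
    StructureRelations (Om G x ^ 2) (fun α ↦ pd α (fun y ↦ Om G y ^ 2) x) (b G x)
      (fun α k ↦ pd α (fun y ↦ b G y k) x) (slashg G x)
      (fun α i j ↦ pd α (fun y ↦ slashg G y i j) x) (chi G x) (chibar G x) (eta G x) (etabar G x)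
      (omega G x) (omegabar G x) where
  symm := (h.pointwise x hx).slashg_symm
  symm' := h.pd_slashg_symm hx
  chi := h.chi_eq hx
  chibar := h.chibar_eq hx
  eta := h.eta_eq hx
  etabar := h.etabar_eq hx
  omega := h.omega_eq hx
  omegabar := h.omegabar_eq hx

theorem ipGam_eq_christoffelForm (h : IsDoubleNullOn G U) (hx : x ∈ U) (X Y W : Fin 4 → ℝ) :
    ipGam G x X Y W = christoffelForm (fun α ↦ pd α (fun y ↦ Om G y ^ 2) x) (b G x)
      (fun α k ↦ pd α (fun y ↦ b G y k) x) (slashg G x)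
      (fun α i j ↦ pd α (fun y ↦ slashg G y i j) x) X Y W :=
  h.ipGam_eq_dNormalForm hx X Y W

theorem nablab_dotProduct (h : IsDoubleNullOn G U) (hx : x ∈ U) (v : Fin 2 → ℝ) (i : Fin 2) :
    nablab G x i ⬝ᵥ slashg G x *ᵥ v = nablabForm (b G x) (fun α k ↦ pd α (fun y ↦ b G y k) x)
      (slashg G x) (fun α i j ↦ pd α (fun y ↦ slashg G y i j) x) v i := by
  have hs := (h.pointwise x hx).slashg_symm 1 0
  simp only [nablabForm, ← h.slashGam_eq hx, nablab, dotProduct, Matrix.mulVec, Matrix.of_apply,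
    Fin.sum_univ_two, hs]
  ring

theorem vecMul_nablab_dotProduct (h : IsDoubleNullOn G U) (hx : x ∈ U) (X v : Fin 2 → ℝ) :
    (X ᵥ* nablab G x) ⬝ᵥ slashg G x *ᵥ v = X ⬝ᵥ nablabForm (b G x)
      (fun α k ↦ pd α (fun y ↦ b G y k) x) (slashg G x)
      (fun α i j ↦ pd α (fun y ↦ slashg G y i j) x) v := by
  rw [← Matrix.dotProduct_mulVec]
  congr 1
  ext i
  exact h.nablab_dotProduct hx v i

end IsDoubleNullOn

/-! ### The second fundamental form of a normal field -/

namespace IsSpacelikeGraph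

variable {G : E4 → Matrix (Fin 4) (Fin 4) ℝ} {U : Set E4} {V : Set E2} {f fbar : E2 → ℝ} {t : E2}
  {N : E2 → Fin 4 → ℝ}

theorem pd_tang (i j : Fin 2) : (fun ν ↦ pd i (fun r ↦ tang f fbar r j ν) t) =
    ![pd i (pd j f) t, pd i (pd j fbar) t, 0, 0] := by
  simp only [tang_eq]
  ext ν
  fin_cases ν
  · rfl
  · rfl
  · exact pd_const _
  · exact pd_const _

theorem differentiableAt_tang (hS : IsSpacelikeGraph G U V f fbar) (ht : t ∈ V) (j : Fin 2)
    (ν : Fin 4) : DifferentiableAt ℝ (fun r ↦ tang f fbar r j ν) t := by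
  simp only [tang_eq]
  fin_cases ν
  · exact differentiableAt_pd hS.isOpen hS.smooth ht j
  · exact differentiableAt_pd hS.isOpen hS.smooth_bar ht j
  · exact differentiableAt_const _
  · exact differentiableAt_const _

/-- If `N` is normal to the surface, then `g(∇ᵢ N, ∂̇ⱼ) = -g(N, ∇ᵢ ∂̇ⱼ)`. -/
theorem ip_covAlong_normal (h : IsDoubleNullOn G U) (hS : IsSpacelikeGraph G U V f fbar)
    (ht : t ∈ V) (hN : ∀ μ, DifferentiableAt ℝ (fun r ↦ N r μ) t) (j : Fin 2)
    (horth : ∀ᶠ r in nhds t, ip G (graph f fbar r) (N r) (tang f fbar r j) = 0) (i : Fin 2) :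
    ip G (graph f fbar t) (covAlong G f fbar i N t) (tang f fbar t j) =
      -ip G (graph f fbar t) (N t) ![pd i (pd j f) t, pd i (pd j fbar) t, 0, 0] -
      ipGam G (graph f fbar t) (tang f fbar t i) (tang f fbar t j) (N t) := by
  have hx := hS.mem t ht
  have hG := fun μ ν ↦ hS.differentiableAt_comp ht (h.differentiable _ hx μ ν)
  have hT := hS.differentiableAt_tang ht j
  have hNG := fun μ ν ↦ (hN μ).fun_mul (hG μ ν)
  have h0 : pd i (fun r ↦ ip G (graph f fbar r) (N r) (tang f fbar r j)) t = 0 := by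
    rw [pd_congr horth, pd_const]
  have h1 : pd i (fun r ↦ ip G (graph f fbar r) (N r) (tang f fbar r j)) t =
      ip G (graph f fbar t) (fun μ ↦ pd i (fun r ↦ N r μ) t) (tang f fbar t j) +
      dip G (graph f fbar t) (tang f fbar t i) (N t) (tang f fbar t j) +
      ip G (graph f fbar t) (N t) (fun ν ↦ pd i (fun r ↦ tang f fbar r j ν) t) := by
    simp only [ip_eq_sum, dip]
    rw [pd_sum _ fun μ _ ↦ DifferentiableAt.fun_sum fun ν _ ↦ (hNG μ ν).fun_mul (hT ν),
      ← Finset.sum_add_distrib, ← Finset.sum_add_distrib]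
    refine Finset.sum_congr rfl fun μ _ ↦ ?_
    rw [pd_sum _ fun ν _ ↦ (hNG μ ν).fun_mul (hT ν), ← Finset.sum_add_distrib,
      ← Finset.sum_add_distrib]
    refine Finset.sum_congr rfl fun ν _ ↦ ?_
    rw [pd_mul (hNG μ ν) (hT ν), pd_mul (hN μ) (hG μ ν),
      hS.pd_comp ht (h.differentiable _ hx μ ν)]
    ring
  have hp := h.pointwise _ hx
  -- Metric compatibility in components: with the symmetry of `dip`, the Koszul expressions for
  -- `g(Γ(∂̇ᵢ, N), ∂̇ⱼ)` and `g(Γ(∂̇ᵢ, ∂̇ⱼ), N)` add up to the derivative of the metric along `∂̇ᵢ`.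
  rw [ip_covAlong, ipGam_eq hp.symm hp.lorentz.isUnit_det,
    ipGam_eq hp.symm hp.lorentz.isUnit_det, ← pd_tang]
  rw [h0] at h1
  rw [h.dip_comm hx _ (tang f fbar t j) (N t), h.dip_comm hx _ (tang f fbar t j) (tang f fbar t i),
    h.dip_comm hx _ (tang f fbar t i) (N t)]
  linarith

/-- The second fundamental form of the surface with respect to the normal field
`N = p L̲ + q L + vᵏ ∂ₖ`. -/
theorem secondForm_eq (h : IsDoubleNullOn G U) (hS : IsSpacelikeGraph G U V f fbar)
    (ht : t ∈ V) (hN : ∀ μ, DifferentiableAt ℝ (fun r ↦ N r μ) t)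
    (horth : ∀ᶠ r in nhds t, ∀ j, ip G (graph f fbar r) (N r) (tang f fbar r j) = 0)
    {p q : ℝ} {v : Fin 2 → ℝ} (hNt : N t = frameVec (b G (graph f fbar t)) p q v) (i j : Fin 2) :
    let x := graph f fbar t
    let o := Om G x ^ 2
    let df : Fin 2 → ℝ := fun i ↦ pd i f t
    let dfb : Fin 2 → ℝ := fun i ↦ pd i fbar t
    ip G x (covAlong G f fbar i N t) (tang f fbar t j) =
      p * chibar G x i j + q * chi G x i j
      + (sdot G f fbar t v (b G x) - 2 * o * q) * hess G f fbar f t i j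
      - 2 * o * p * hess G f fbar fbar t i j
      - 2 * sym (chi G x *ᵥ v + (2 * o * p) • etabar G x) dfb i j
      + 2 * sym ((fun i ↦ sdot G f fbar t (nablab G x i) v) - chibar G x *ᵥ v
          - p • chibar G x *ᵥ b G x - q • chi G x *ᵥ b G x - (2 * o * q) • eta G x) df i j
      + 2 * (2 * o * (eta G x ⬝ᵥ v) + b G x ⬝ᵥ chi G x *ᵥ v
          + 2 * o * p * (b G x ⬝ᵥ etabar G x)) * sym df dfb i j
      - 4 * p * omega G x * o * (dfb i * dfb j)
      + (2 * (b G x ⬝ᵥ chibar G x *ᵥ v) + p * (b G x ⬝ᵥ chibar G x *ᵥ b G x)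
          + q * (b G x ⬝ᵥ chi G x *ᵥ b G x) + 4 * o * q * (b G x ⬝ᵥ eta G x)
          - sdot G f fbar t (b G x ᵥ* nablab G x) v + sdot G f fbar t (dsb G x) v
          - 4 * o * q * omegabar G x) * (df i * df j) := by
  intro x o df dfb
  have hx := hS.mem t ht
  have hp := h.pointwise _ hx
  -- Since `Bₖ = δₖ - fₖb`, normality says that the lowered `vₖ` equals `(v·b - 2Ω²q)fₖ - 2Ω²p f̲ₖ`.
  have horth' : ∀ k, 2 * o * (p * dfb k + q * df k) + v ⬝ᵥ slashg G x *ᵥ B G f fbar t k = 0 := by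
    intro k
    have h1 := horth.self_of_nhds k
    rw [hNt, hp.ip_frameVec, angPart_tang] at h1
    simpa [tang_eq] using h1
  have key := christoffelForm_tangent_tangent (h.structureRelations hx) p q v df dfb i j
  have hnb : (fun i ↦ sdot G f fbar t (nablab G x i) v) = nablabForm (b G x)
      (fun α k ↦ pd α (fun y ↦ b G y k) x) (slashg G x)
      (fun α i j ↦ pd α (fun y ↦ slashg G y i j) x) v :=
    funext fun i ↦ h.nablab_dotProduct hx v i
  have hDb : sdot G f fbar t (b G x ᵥ* nablab G x) v = b G x ⬝ᵥ nablabForm (b G x)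
      (fun α k ↦ pd α (fun y ↦ b G y k) x) (slashg G x)
      (fun α i j ↦ pd α (fun y ↦ slashg G y i j) x) v :=
    h.vecMul_nablab_dotProduct hx _ v
  have hds : sdot G f fbar t (dsb G x) v =
    (fun k ↦ pd 0 (fun y ↦ b G y k) x) ⬝ᵥ slashg G x *ᵥ v := rfl
  rw [ip_covAlong_normal h hS ht hN j (horth.mono fun r hr ↦ hr j) i,
    h.ipGam_eq_christoffelForm hx, tang_eq f fbar t i, tang_eq f fbar t j, hNt, hp.ip_frameVec,
    hnb, hDb, hds, sub_eq_add_neg]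
  have hform : frameVec (b G x) p q v = ![p, q, p * b G x 0 + v 0, p * b G x 1 + v 1] := rfl
  rw [hform]
  refine (congrArg _ key).trans ?_
  have hΓ := fun l ↦ h.slashGam_eq hx l i j
  simp only [← hΓ]
  have o0 := horth' 0
  have o1 := horth' 1
  have hs := hp.slashg_symm 1 0
  simp only [dotProduct, Matrix.mulVec, Fin.sum_univ_two, B, Matrix.of_apply] at o0 o1
  simp at o0 o1
  -- Inserting this value of `vₖ` into `-Γ̸ᵏᵢⱼvₖ` supplies exactly the Christoffel terms that
  -- complete the second derivatives of `f` and `f̲` to Hessians with the same coefficients.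
  have hH : -(2 * o * (p * pd i (pd j fbar) t + q * pd i (pd j f) t) +
      v ⬝ᵥ slashg G x *ᵥ angPart (b G x) ![pd i (pd j f) t, pd i (pd j fbar) t, 0, 0])
      - ∑ l, (∑ k, slashg G x l k * slashGam G x k i j) * v l =
      (sdot G f fbar t v (b G x) - 2 * o * q) * hess G f fbar f t i j
      - 2 * o * p * hess G f fbar fbar t i j := by
    simp only [sdot, hess, dotProduct, Matrix.mulVec, Fin.sum_univ_two, angPart, ang]
    simp
    have hs' : slashg G (graph f fbar t) 1 0 = slashg G (graph f fbar t) 0 1 := hs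
    simp only [x, o, df, dfb, hs'] at o0 o1 ⊢
    linear_combination (-slashGam G x 0 i j) * o0 + (-slashGam G x 1 i j) * o1
  simp only [Matrix.cons_val_zero, Matrix.cons_val_one]
  linear_combination hH

end IsSpacelikeGraph

theorem LorentzMetric.isDoubleNullOn {M : Type*} [TopologicalSpace M] [ChartedSpace E4 M]
    [IsManifold (𝓡 4) ∞ M] {g : LorentzMetric M} {φ : OpenPartialHomeomorph M E4}
    (hφ : IsDoubleNull g φ) : IsDoubleNullOn (g.comp φ) φ.target where
  isOpen := φ.open_target
  differentiable _ hx μ ν := (g.contDiffAt_comp hφ.chart hx μ ν).differentiableAt (by simp)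
  pointwise _ hx := hφ.isDoubleNullAt hx

/-! ### Regularity of the null frame and the torsion -/

namespace IsSpacelikeGraph

variable {G : E4 → Matrix (Fin 4) (Fin 4) ℝ} {U : Set E4} {V : Set E2} {f fbar : E2 → ℝ} {t : E2}

theorem differentiableAt_frameVec (h : IsDoubleNullOn G U) (hS : IsSpacelikeGraph G U V f fbar)
    (ht : t ∈ V) {p q : E2 → ℝ} {v : E2 → Fin 2 → ℝ} (hp : DifferentiableAt ℝ p t)
    (hq : DifferentiableAt ℝ q t) (hv : ∀ k, DifferentiableAt ℝ (fun r ↦ v r k) t) (μ : Fin 4) :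
    DifferentiableAt ℝ (fun r ↦ frameVec (b G (graph f fbar r)) (p r) (q r) (v r) μ) t := by
  have hb := fun k ↦ hS.differentiableAt_comp ht (h.differentiableAt_b (hS.mem t ht) k)
  fin_cases μ
  exacts [hp, hq, (hp.fun_mul (hb 0)).fun_add (hv 0), (hp.fun_mul (hb 1)).fun_add (hv 1)]

theorem dotL_eventuallyEq (h : IsDoubleNullOn G U) (hS : IsSpacelikeGraph G U V f fbar)
    (ht : t ∈ V) : dotL G f fbar =ᶠ[nhds t] fun r ↦
      frameVec (b G (graph f fbar r)) (eps G f fbar r) 1 (epsVec G f fbar r) := by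
  filter_upwards [hS.isOpen.mem_nhds ht] with r hr
  exact dotL_eq (isDoubleNullAt h hS hr)

theorem dotLbar_eventuallyEq (h : IsDoubleNullOn G U) (hS : IsSpacelikeGraph G U V f fbar)
    (ht : t ∈ V) : dotLbar G f fbar =ᶠ[nhds t] fun r ↦
      frameVec (b G (graph f fbar r)) 1 (epsbar G f fbar r) (epsbarVec G f fbar r) := by
  filter_upwards [hS.isOpen.mem_nhds ht] with r hr
  exact dotLbar_eq (isDoubleNullAt h hS hr)

theorem differentiableAt_dotL (h : IsDoubleNullOn G U) (hS : IsSpacelikeGraph G U V f fbar)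
    (ht : t ∈ V) (hB : IsUnit (B G f fbar t)) (μ : Fin 4) :
    DifferentiableAt ℝ (fun r ↦ dotL G f fbar r μ) t :=
  ((dotL_eventuallyEq h hS ht).fun_comp (· μ)).differentiableAt_iff.2 <|
    differentiableAt_frameVec h hS ht (differentiableAt_eps h hS ht hB)
      (differentiableAt_const _) (differentiableAt_epsVec h hS ht hB) μ

theorem differentiableAt_dotLbar (h : IsDoubleNullOn G U) (hS : IsSpacelikeGraph G U V f fbar)
    (ht : t ∈ V) (hB : IsUnit (B G f fbar t)) (μ : Fin 4) :
    DifferentiableAt ℝ (fun r ↦ dotLbar G f fbar r μ) t :=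
  ((dotLbar_eventuallyEq h hS ht).fun_comp (· μ)).differentiableAt_iff.2 <|
    differentiableAt_frameVec h hS ht (differentiableAt_const _)
      (differentiableAt_epsbar h hS ht hB) (differentiableAt_epsbarVec h hS ht hB) μ

theorem pd_dotLbar (h : IsDoubleNullOn G U) (hS : IsSpacelikeGraph G U V f fbar)
    (ht : t ∈ V) (hB : IsUnit (B G f fbar t)) (i : Fin 2) :
    (fun μ ↦ pd i (fun r ↦ dotLbar G f fbar r μ) t) = ![0, pd i (epsbar G f fbar) t,
      dirD (tang f fbar t i) (fun y ↦ b G y 0) (graph f fbar t) +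
        pd i (fun r ↦ epsbarVec G f fbar r 0) t,
      dirD (tang f fbar t i) (fun y ↦ b G y 1) (graph f fbar t) +
        pd i (fun r ↦ epsbarVec G f fbar r 1) t] := by
  have hx := hS.mem t ht
  have hb := fun k ↦ hS.differentiableAt_comp ht (h.differentiableAt_b hx k)
  have hv := differentiableAt_epsbarVec h hS ht hB
  have hk : ∀ k, pd i (fun r ↦ 1 * b G (graph f fbar r) k + epsbarVec G f fbar r k) t =
      dirD (tang f fbar t i) (fun y ↦ b G y k) (graph f fbar t) +
        pd i (fun r ↦ epsbarVec G f fbar r k) t := by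
    intro k
    rw [pd_add ((hb k).const_mul _) (hv k), pd_const_mul _ (hb k),
      hS.pd_comp ht (h.differentiableAt_b hx k), one_mul]
  ext μ
  refine (pd_congr ((dotLbar_eventuallyEq h hS ht).fun_comp (· μ))).trans ?_
  fin_cases μ
  · exact pd_const _
  · rfl
  · exact hk 0
  · exact hk 1

/-- The components of `L̲̇` are differentiated directly. Its `s`-component is constantly `1`, so
only `ε̲`, `b` and `ε̲ᵏ` contribute besides the connection term. -/
theorem torsion_eq (h : IsDoubleNullOn G U) (hS : IsSpacelikeGraph G U V f fbar)
    (ht : t ∈ V) (hB : IsUnit (B G f fbar t)) (i : Fin 2) :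
    let x := graph f fbar t
    let o := Om G x ^ 2
    let ε := eps G f fbar t
    let εb := epsbar G f fbar t
    let εv := epsVec G f fbar t
    let εbv := epsbarVec G f fbar t
    ip G x (covAlong G f fbar i (dotLbar G f fbar) t) (dotL G f fbar t) =
      2 * o * eta G x i + 2 * o * ε * εb * etabar G x i - (chi G x *ᵥ εbv) i
        + εb * (chi G x *ᵥ εv) i + (chibar G x *ᵥ εv) i - ε * (chibar G x *ᵥ εbv) i
        + pd i f t * (4 * o * omegabar G x - 2 * o * (b G x ⬝ᵥ eta G x)
            - 2 * o * ε * εb * (b G x ⬝ᵥ etabar G x)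
            + 2 * o * (εbv ⬝ᵥ eta G x) - 2 * o * εb * (eta G x ⬝ᵥ εv)
            + b G x ⬝ᵥ chi G x *ᵥ εbv - εb * (b G x ⬝ᵥ chi G x *ᵥ εv)
            + εbv ⬝ᵥ chibar G x *ᵥ εv - b G x ⬝ᵥ chibar G x *ᵥ εv
            + ε * (b G x ⬝ᵥ chibar G x *ᵥ εbv) - sdot G f fbar t (εbv ᵥ* nablab G x) εv)
        + pd i fbar t * (-(2 * o * (etabar G x ⬝ᵥ εv)) + 2 * o * ε * (etabar G x ⬝ᵥ εbv)
            + 4 * o * ε * εb * omega G x + chi G x *ᵥ εv ⬝ᵥ εbv)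
        + 2 * o * ε * pd i (epsbar G f fbar) t
        + sdot G f fbar t (nablaVec G f fbar (epsbarVec G f fbar) t i) εv := by
  intro x o ε εb εv εbv
  have hx := hS.mem t ht
  have hp := h.pointwise _ hx
  have key := christoffelForm_tangent_normal (h.structureRelations hx) ε εb εv εbv
    (fun i ↦ pd i f t) (fun i ↦ pd i fbar t) i
  have hDb : sdot G f fbar t (εbv ᵥ* nablab G x) εv = εbv ⬝ᵥ nablabForm (b G x)
      (fun α k ↦ pd α (fun y ↦ b G y k) x) (slashg G x)
      (fun α i j ↦ pd α (fun y ↦ slashg G y i j) x) εv :=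
    h.vecMul_nablab_dotProduct hx _ εv
  have hform : frameVec (b G x) 1 εb εbv = ![1, εb, b G x 0 + εbv 0, b G x 1 + εbv 1] := by
    simp [frameVec]
  have hform' : frameVec (b G x) ε 1 εv = ![ε, 1, ε * b G x 0 + εv 0, ε * b G x 1 + εv 1] := rfl
  rw [ip_covAlong, pd_dotLbar h hS ht hB, dotL_eq hp, dotLbar_eq hp, hDb,
    ip_comm hp.symm, hp.ip_frameVec, h.ipGam_eq_christoffelForm hx]
  rw [hform, hform', tang_eq]
  set W : Fin 4 → ℝ := ![0, pd i (epsbar G f fbar) t,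
      dirD ![pd i f t, pd i fbar t, if i = 0 then 1 else 0, if i = 1 then 1 else 0]
        (fun y ↦ b G y 0) (graph f fbar t) + pd i (fun r ↦ epsbarVec G f fbar r 0) t,
      dirD ![pd i f t, pd i fbar t, if i = 0 then 1 else 0, if i = 1 then 1 else 0]
        (fun y ↦ b G y 1) (graph f fbar t) +
        pd i (fun r ↦ epsbarVec G f fbar r 1) t] with hW
  have hΓ := fun l m ↦ h.slashGam_eq hx l i m
  simp only [← hΓ] at key
  have hs : slashg G (graph f fbar t) 1 0 = slashg G (graph f fbar t) 0 1 := hp.slashg_symm 1 0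
  -- The derivative of `ε̲ᵏ` and the sum of Christoffel symbols of `g̸` left over in `key` combine
  -- to `∇̸ᵢε̲ᵏ`; the derivative of `b` matches the first sum in `key`.
  have hlin : 2 * Om G (graph f fbar t) ^ 2 *
      (ε * W 1 + 1 * W 0) +
      εv ⬝ᵥ slashg G (graph f fbar t) *ᵥ angPart (b G (graph f fbar t)) W +
      ∑ l, ∑ m, (∑ k, slashg G x l k * slashGam G x k i m) * εbv m * εv l =
      ∑ k, ∑ l, slashg G x k l * (pd i f t * pd 0 (fun y ↦ b G y k) x +
        pd i fbar t * pd 1 (fun y ↦ b G y k) x + pd (ang i) (fun y ↦ b G y k) x) * εv l +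
      2 * o * ε * pd i (epsbar G f fbar) t
        + sdot G f fbar t (nablaVec G f fbar (epsbarVec G f fbar) t i) εv := by
    simp only [sdot, nablaVec, dotProduct, Matrix.mulVec, Fin.sum_univ_two, angPart, ang]
    fin_cases i <;> simp [hW, dirD, Fin.sum_univ_four, x, o, hs, εbv] <;> ring
  linear_combination key + hlin

end IsSpacelikeGraph
end DoubleNull

end

open DoubleNull in
theorem proposition4p1 {M : Type*} [TopologicalSpace M] [ChartedSpace E4 M] [IsManifold (𝓡 4) ∞ M]
    (g : LorentzMetric M) (φ : OpenPartialHomeomorph M E4) (hφ : IsDoubleNull g φ)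
    (V : Set E2) (f fbar : E2 → ℝ) (hS : IsSpacelikeGraph (g.comp φ) φ.target V f fbar)
    (t : E2) (ht : t ∈ V) (hB : IsUnit (B (g.comp φ) f fbar t)) :
    let G := g.comp φ
    let x : E4 := graph f fbar t
    let Ω : ℝ := Om G x
    let b : Fin 2 → ℝ := b G x
    let χ := chi G x
    let χb := chibar G x
    let η := eta G x
    let ηb := etabar G x
    let w : ℝ := omega G x
    let wb : ℝ := omegabar G x
    let ε : ℝ := eps G f fbar t
    let εb : ℝ := epsbar G f fbar t
    let εv : Fin 2 → ℝ := epsVec G f fbar t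
    let εbv : Fin 2 → ℝ := epsbarVec G f fbar t
    let df : Fin 2 → ℝ := fun i ↦ pd i f t
    let dfb : Fin 2 → ℝ := fun i ↦ pd i fbar t
    -- the inner product of the metric of the leaves, and the covariant derivative of `b`
    let dot : (Fin 2 → ℝ) → (Fin 2 → ℝ) → ℝ := sdot G f fbar t
    let Db : (Fin 2 → ℝ) → (Fin 2 → ℝ) := fun X ↦ X ᵥ* nablab G x
    -- the one-form `(∇̸ b · W)ᵢ`
    let nb : (Fin 2 → ℝ) → (Fin 2 → ℝ) := fun W i ↦ dot (nablab G x i) W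
    -- the frame is a null normal frame of the surface
    (ip G x (dotLbar G f fbar t) (dotLbar G f fbar t) = 0 ∧
      ip G x (dotL G f fbar t) (dotL G f fbar t) = 0 ∧
      (∀ i, ip G x (dotLbar G f fbar t) (tang f fbar t i) = 0) ∧
      (∀ i, ip G x (dotL G f fbar t) (tang f fbar t i) = 0) ∧
      ip G x (dotLbar G f fbar t) (dotL G f fbar t) = 2 * Ω ^ 2 * (1 + ε * εb) + dot εv εbv ∧
      0 < 2 * Ω ^ 2 * (1 + ε * εb) + dot εv εbv) ∧
    (∀ i j, dotChibar G f fbar t i j =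
      χb i j + εb * χ i j + (dot εbv b - 2 * Ω ^ 2 * εb) * hess G f fbar f t i j
      - 2 * Ω ^ 2 * hess G f fbar fbar t i j
      - 2 * sym (χ *ᵥ εbv + (2 * Ω ^ 2) • ηb) dfb i j
      + 2 * sym (nb εbv - χb *ᵥ εbv - χb *ᵥ b - εb • χ *ᵥ b - (2 * Ω ^ 2 * εb) • η) df i j
      + 2 * (2 * Ω ^ 2 * (η ⬝ᵥ εbv) + b ⬝ᵥ χ *ᵥ εbv + 2 * Ω ^ 2 * (b ⬝ᵥ ηb)) * sym df dfb i j
      - 4 * w * Ω ^ 2 * (dfb i * dfb j)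
      + (2 * (b ⬝ᵥ χb *ᵥ εbv) + b ⬝ᵥ χb *ᵥ b + εb * (b ⬝ᵥ χ *ᵥ b)
          + 4 * Ω ^ 2 * εb * (b ⬝ᵥ η) - dot (Db b) εbv + dot (dsb G x) εbv
          - 4 * Ω ^ 2 * εb * wb) * (df i * df j)) ∧
    (∀ i j, dotChi G f fbar t i j =
      χ i j + ε * χb i j + (dot εv b - 2 * Ω ^ 2) * hess G f fbar f t i j
      - 2 * Ω ^ 2 * ε * hess G f fbar fbar t i j
      - 2 * sym (χ *ᵥ εv + (2 * Ω ^ 2 * ε) • ηb) dfb i j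
      + 2 * sym (nb εv - χb *ᵥ εv - ε • χb *ᵥ b - χ *ᵥ b - (2 * Ω ^ 2) • η) df i j
      + 2 * (2 * Ω ^ 2 * (η ⬝ᵥ εv) + b ⬝ᵥ χ *ᵥ εv + 2 * Ω ^ 2 * ε * (b ⬝ᵥ ηb)) * sym df dfb i j
      - 4 * ε * w * Ω ^ 2 * (dfb i * dfb j)
      + (2 * (b ⬝ᵥ χb *ᵥ εv) + b ⬝ᵥ χ *ᵥ b + ε * (b ⬝ᵥ χb *ᵥ b)
          + 4 * Ω ^ 2 * (b ⬝ᵥ η) - dot (Db b) εv + dot (dsb G x) εv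
          - 4 * Ω ^ 2 * wb) * (df i * df j)) ∧
    (∀ i, dotEta G f fbar t i =
      (2 * Ω ^ 2 * (1 + ε * εb) + dot εv εbv)⁻¹ *
      (2 * Ω ^ 2 * η i + 2 * Ω ^ 2 * ε * εb * ηb i - (χ *ᵥ εbv) i + εb * (χ *ᵥ εv) i
        + (χb *ᵥ εv) i - ε * (χb *ᵥ εbv) i
        + df i * (4 * Ω ^ 2 * wb - 2 * Ω ^ 2 * (b ⬝ᵥ η) - 2 * Ω ^ 2 * ε * εb * (b ⬝ᵥ ηb)
            + 2 * Ω ^ 2 * (εbv ⬝ᵥ η) - 2 * Ω ^ 2 * εb * (η ⬝ᵥ εv)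
            + b ⬝ᵥ χ *ᵥ εbv - εb * (b ⬝ᵥ χ *ᵥ εv) + εbv ⬝ᵥ χb *ᵥ εv - b ⬝ᵥ χb *ᵥ εv
            + ε * (b ⬝ᵥ χb *ᵥ εbv) - dot (Db εbv) εv)
        + dfb i * (-(2 * Ω ^ 2 * (ηb ⬝ᵥ εv)) + 2 * Ω ^ 2 * ε * (ηb ⬝ᵥ εbv)
            + 4 * Ω ^ 2 * ε * εb * w + χ *ᵥ εv ⬝ᵥ εbv)
        + 2 * Ω ^ 2 * ε * pd i (epsbar G f fbar) t
        + dot (nablaVec G f fbar (epsbarVec G f fbar) t i) εv)) := by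
  intro G x Ω b χ χb η ηb w wb ε εb εv εbv df dfb dot Db nb
  have h : IsDoubleNullOn G φ.target := LorentzMetric.isDoubleNullOn hφ
  have hnull := fun r hr (hBr : IsUnit (B G f fbar r)) ↦
    null_frame (IsSpacelikeGraph.isDoubleNullAt h hS hr) (hS.spacelike r hr) hBr
  have hev := IsSpacelikeGraph.eventually_isUnit_B h hS ht hB
  have hx := IsSpacelikeGraph.isDoubleNullAt h hS ht
  refine ⟨hnull t ht hB, fun i j ↦ ?_, fun i j ↦ ?_, fun i ↦ ?_⟩
  -- Here `p = 1` and `q = ε̲`; the next case, for `L̇`, has `p = ε` and `q = 1`.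
  · refine (IsSpacelikeGraph.secondForm_eq h hS ht
      (IsSpacelikeGraph.differentiableAt_dotLbar h hS ht hB)
      (hev.mono fun r hr ↦ (hnull r hr.1 hr.2).2.2.1) (dotLbar_eq hx) i j).trans ?_
    simp only [one_smul, mul_one, one_mul]
    rfl
  · refine (IsSpacelikeGraph.secondForm_eq h hS ht
      (IsSpacelikeGraph.differentiableAt_dotL h hS ht hB)
      (hev.mono fun r hr ↦ (hnull r hr.1 hr.2).2.2.2.1) (dotL_eq hx) i j).trans ?_
    simp only [one_smul, mul_one, one_mul]
    rw [add_comm (_ * chibar _ _ _ _)]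
    ring
  · have hn := (hnull t ht hB).2.2.2.2.1
    -- `Ω̇²` is half of `g(L̲̇, L̇)`, and the resulting factor `2` cancels the `½` in the definition
    -- of the torsion.
    have hd : (dotOmSq G f fbar t)⁻¹ =
        2 * (2 * Ω ^ 2 * (1 + ε * εb) + dot εv εbv)⁻¹ := by
      rw [dotOmSq, hn, mul_inv]
      norm_num
      rfl
    have ht' := IsSpacelikeGraph.torsion_eq h hS ht hB i
    rw [dotEta, dotLp, ip_smul_right, hd, ht']
    ring
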